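/- Let $m,K\ge 0$ be integers and $T>0$. Let $H:[0,T]\to\mathbb C^{m\times m}$ be Hermitian-valued and $\gamma_1,\dots,\gamma_K:[0,T]\to[0,\infty)$, with $H$ and all $\gamma_k$ twice continuously differentiable, and let $L_1,\dots,L_K\in\mathbb C^{m\times m}$. Let $\rho:[0,T]\to\mathbb C^{m\times m}$ be a solution of the Lindblad equation $$\dot\rho(t)=-i[H(t),\rho(t)]+\sum_{k=1}^K\gamma_k(t)\Big(L_k\rho(t)L_k^\dagger-\tfrac12\{L_k^\dagger L_k,\rho(t)\}\Big)$$ whose initial value $\rho(0)$ is Hermitian and positive semidefinite with unit trace. Put $A(t)=-iH(t)-\frac12\sum_k\gamma_k(t)L_k^\dagger L_k$. For a step size $\tau$, a time $t$ and a matrix $X$, let $$Y=e^{\frac\tau2A(t)}\Big(X+\tfrac\tau2\sum_k\gamma_k(t)L_kXL_k^\dagger\Big)e^{\frac\tau2A(t)^\dagger},\qquad s=t+\tfrac\tau2,$$ $$\Phi_\tau(t,X)=e^{\tau A(s)}Xe^{\tau A(s)^\dagger}+\tau\sum_k\gamma_k(s)\,e^{\frac\tau2A(s)}L_kYL_k^\dagger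 e^{\frac\tau2A(s)^\dagger}.$$ For an integer $N\ge1$ let $\tau=T/N$, $t_n=n\tau$. The unnormalized full-rank exponential midpoint scheme is $\rho_{n+1}=\Phi_\tau(t_n,\rho_n)$ with $\rho_0=\rho(0)$. Let $\|X\|_1=\operatorname{Tr}\sqrt{X^\dagger X}$ be the trace norm and $$C_2=\sum_{k=1}^K\Big(\max_{0\le t\le T}\gamma_k(t)\Big)\|L_k\|_1^2 .$$ Theorem. Some $M$ bounds, in modulus on $[0,T]$, the entries of all $L_k$ and the values and first and second derivatives of all $\gamma_k$ and of all entries of $A$ and $\rho$. For every such $M$ there is a constant $C_1>0$, depending only on $m$, $K$ and $M$, such that for all $N\ge1$ $$\|\rho(t_{n+1})-\Phi_\tau(t_n,\rho(t_n))\|_1\le C_1\tau^3\quad(0\le n<N),\qquad \|\rho(t_n)-\rho_n\|_1\le C_3\tau^2\quad(0\le n\le N),$$ where $C_3=\frac{C_1}{C_2}\left(e^{C_2T}-1\right)>0$, to be read as its limiting value $C_1T$ if $C_2=0$. -/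

import Mathlib

open Set
open scoped Matrix ComplexOrder

noncomputable section

namespace FREM

/-- The trace norm `‖X‖₁ = Tr √(X† X)`: the sum of the singular values of `X`, that is, of the
square roots of the eigenvalues (with multiplicity) of the Hermitian matrix `X† X`. -/
def traceNorm {m : ℕ} (X : Matrix (Fin m) (Fin m) ℂ) : ℝ :=
  ∑ i, Real.sqrt ((Matrix.isHermitian_conjTranspose_mul_self X).eigenvalues i)

/-- Density matrices: Hermitian, positive semidefinite, of unit trace. -/
def IsDensityMatrix {m : ℕ} (X : Matrix (Fin m) (Fin m) ℂ) : Prop :=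
  X.PosSemidef ∧ X.trace = 1

/-- The data of a Lindblad equation with `K` channels on `m × m` matrices: the (time dependent)
Hamiltonian `H`, the decay parameters `γ k` and the jump operators `L k`. -/
structure LindbladData (m K : ℕ) where
  H : ℝ → Matrix (Fin m) (Fin m) ℂ
  γ : Fin K → ℝ → ℝ
  L : Fin K → Matrix (Fin m) (Fin m) ℂ

namespace LindbladData

variable {m K : ℕ} (S : LindbladData m K)

/-- On `[0, T]` the Hamiltonian is Hermitian, the decay parameters are nonnegative, and both are
twice continuously differentiable. -/
structure Admissible (T : ℝ) : Prop where
  hermitian : ∀ t ∈ Icc 0 T, (S.H t).IsHermitian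
  nonneg : ∀ k, ∀ t ∈ Icc 0 T, 0 ≤ S.γ k t
  contDiffOn_H : ∀ a b, ContDiffOn ℝ 2 (fun t => S.H t a b) (Icc 0 T)
  contDiffOn_γ : ∀ k, ContDiffOn ℝ 2 (S.γ k) (Icc 0 T)

/-- The right-hand side of the Lindblad equation,
`-i [H(t), X] + ∑ k, γ_k(t) (L_k X L_k† - ½ {L_k† L_k, X})`. -/
def rhs (t : ℝ) (X : Matrix (Fin m) (Fin m) ℂ) : Matrix (Fin m) (Fin m) ℂ :=
  (-Complex.I) • (S.H t * X - X * S.H t) +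
    ∑ k, (S.γ k t : ℂ) • (S.L k * X * (S.L k)ᴴ -
      (1 / 2 : ℂ) • ((S.L k)ᴴ * S.L k * X + X * ((S.L k)ᴴ * S.L k)))

/-- `ρ` solves the Lindblad equation on `[0, T]` (one-sided derivatives at the end points). -/
def IsSolution (T : ℝ) (ρ : ℝ → Matrix (Fin m) (Fin m) ℂ) : Prop :=
  ∀ t ∈ Icc 0 T, ∀ a b,
    HasDerivWithinAt (fun s => ρ s a b) (S.rhs t (ρ t) a b) (Icc 0 T) t

/-- `A(t) = -i H(t) - ½ ∑ k, γ_k(t) L_k† L_k`. -/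
def A (t : ℝ) : Matrix (Fin m) (Fin m) ℂ :=
  (-Complex.I) • S.H t - (1 / 2 : ℂ) • ∑ k, (S.γ k t : ℂ) • ((S.L k)ᴴ * S.L k)

/-- `E h t = exp (h A(t))`. -/
def E (h t : ℝ) : Matrix (Fin m) (Fin m) ℂ := NormedSpace.exp ((h : ℂ) • S.A t)

/-- The intermediate value of the scheme at `t + τ / 2`, for a step of size `τ` from `X` at `t`:
`e^{(τ/2) A(t)} (X + (τ/2) ∑ k, γ_k(t) L_k X L_k†) e^{(τ/2) A(t)†}`. -/
def halfStep (τ t : ℝ) (X : Matrix (Fin m) (Fin m) ℂ) : Matrix (Fin m) (Fin m) ℂ :=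
  S.E (τ / 2) t *
    (X + ((τ / 2 : ℝ) : ℂ) • ∑ k, (S.γ k t : ℂ) • (S.L k * X * (S.L k)ᴴ)) *
    NormedSpace.exp (((τ / 2 : ℝ) : ℂ) • (S.A t)ᴴ)

/-- One step `Φ(t, X)` of size `τ` of the unnormalized full-rank exponential midpoint scheme:
with `s = t + τ / 2` and `Y` the intermediate value,
`e^{τ A(s)} X e^{τ A(s)†} + τ ∑ k, γ_k(s) e^{(τ/2) A(s)} L_k Y L_k† e^{(τ/2) A(s)†}`. -/
def step (τ t : ℝ) (X : Matrix (Fin m) (Fin m) ℂ) : Matrix (Fin m) (Fin m) ℂ :=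
  S.E τ (t + τ / 2) * X * NormedSpace.exp ((τ : ℂ) • (S.A (t + τ / 2))ᴴ) +
    (τ : ℂ) • ∑ k, (S.γ k (t + τ / 2) : ℂ) •
      (S.E (τ / 2) (t + τ / 2) * S.L k * S.halfStep τ t X * (S.L k)ᴴ *
        NormedSpace.exp (((τ / 2 : ℝ) : ℂ) • (S.A (t + τ / 2))ᴴ))

/-- The numerical solution `ρ_n`: `ρ_{n+1} = Φ(t_n, ρ_n)` with `t_n = n τ`, started from `ρ₀`. -/
def numSol (τ : ℝ) (ρ₀ : Matrix (Fin m) (Fin m) ℂ) : ℕ → Matrix (Fin m) (Fin m) ℂ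
  | 0 => ρ₀
  | n + 1 => S.step τ (n * τ) (numSol τ ρ₀ n)

/-- `M` bounds, on `[0, T]`, the entries of the `L_k`, and the values and first and second
derivatives of the `γ_k` and of the entries of `A` and `ρ`. -/
structure BoundedBy (T M : ℝ) (ρ : ℝ → Matrix (Fin m) (Fin m) ℂ) : Prop where
  bound_L : ∀ k a b, ‖S.L k a b‖ ≤ M
  bound_γ : ∀ k, ∀ j ≤ 2, ∀ t ∈ Icc 0 T,
    |iteratedDerivWithin j (S.γ k) (Icc 0 T) t| ≤ M
  bound_A : ∀ a b, ∀ j ≤ 2, ∀ t ∈ Icc 0 T,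
    ‖iteratedDerivWithin j (fun s => S.A s a b) (Icc 0 T) t‖ ≤ M
  bound_ρ : ∀ a b, ∀ j ≤ 2, ∀ t ∈ Icc 0 T,
    ‖iteratedDerivWithin j (fun s => ρ s a b) (Icc 0 T) t‖ ≤ M

/-- `C₂ = ∑ k, (max_{0 ≤ t ≤ T} γ_k(t)) ‖L_k‖₁²`. -/
def C₂ (T : ℝ) : ℝ := ∑ k, sSup (S.γ k '' Icc 0 T) * traceNorm (S.L k) ^ 2

end LindbladData

/-- `C₃ = (C₁ / C₂) (e^{C₂ T} - 1)`, read as its limit `C₁ T` if `C₂ = 0`. -/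
def C₃ (C₁ C₂ T : ℝ) : ℝ :=
  if C₂ = 0 then C₁ * T else C₁ / C₂ * (Real.exp (C₂ * T) - 1)

end FREM

end

/-! The proof is consistency plus stability, both in the trace norm.

Stability: `A + A†` is minus a nonnegative combination of the `L_k† L_k`, so every exponential in
the scheme is an operator-norm contraction. With Hölder's inequality and `‖L_k‖ ≤ ‖L_k‖₁`, one step
multiplies the trace norm by at most `1 + x + x²/2 ≤ e^x`, `x = C₂ τ` (`traceNorm_step_le`). The
step is linear in `X`, so errors propagate by the same factor, and a discrete Gronwall argument
turns local errors `C₁ τ³` into the global bound (`traceNorm_sub_numSol_le`).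

Consistency: the midpoint rule for `ρ'` is exact up to `O(τ³)`, and expanding the scheme with
coefficients frozen at the midpoint gives the same terms up to order `τ²` (`isOrd_midpoint`). The
third derivative of `ρ` never appears: by the equation `ρ'` is a polynomial in functions with
bounded second derivatives, hence has a first-order expansion with an `O(τ²)` remainder.

Uniformity: `C₁` may depend on `m`, `K`, `M` only. All Landau estimates are therefore made along
principal filters on `LocalStep m K M`, the type of all possible steps, where `O(τⁿ)` means a single
constant for all data. Taylor expansion covers `τ ≤ 1`; for `τ ≥ 1` the crude growth `O(τ²)` of the
scheme suffices (`isOrd_large`). -/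

noncomputable section

namespace FREM

/-! ### Trace norm: polar decomposition, Hölder's inequality and duality. -/

section TraceNorm

open Matrix
open scoped Matrix.Norms.L2Operator

variable {m : ℕ}

lemma norm_one_matrix_le : ‖(1 : Matrix (Fin m) (Fin m) ℂ)‖ ≤ 1 := by
  rw [← Matrix.diagonal_one, Matrix.l2_opNorm_diagonal]
  exact (pi_norm_le_iff_of_nonneg zero_le_one).2 fun i => by simp

lemma norm_le_one_of_mul_conjTranspose_norm_le {U : Matrix (Fin m) (Fin m) ℂ}
    (h : ‖U * Uᴴ‖ ≤ 1) : ‖U‖ ≤ 1 := by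
  have h1 : ‖U * star U‖ = ‖U‖ * ‖U‖ := CStarRing.norm_self_mul_star
  rw [Matrix.star_eq_conjTranspose] at h1
  nlinarith [norm_nonneg U]

lemma norm_unitary_le (U : Matrix.unitaryGroup (Fin m) ℂ) :
    ‖(U : Matrix (Fin m) (Fin m) ℂ)‖ ≤ 1 := by
  apply norm_le_one_of_mul_conjTranspose_norm_le
  rw [← Matrix.star_eq_conjTranspose, Unitary.mul_star_self_of_mem U.2]
  exact norm_one_matrix_le

lemma norm_apply_le (X : Matrix (Fin m) (Fin m) ℂ) (a b : Fin m) : ‖X a b‖ ≤ ‖X‖ := by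
  have h := Matrix.l2_opNorm_mulVec X (EuclideanSpace.single b (1 : ℂ))
  rw [PiLp.norm_single, norm_one, mul_one] at h
  refine le_trans ?_ h
  have h2 := PiLp.norm_apply_le
    ((EuclideanSpace.equiv (Fin m) ℂ).symm (X *ᵥ (EuclideanSpace.single b (1 : ℂ)).ofLp)) a
  simpa using h2

lemma norm_trace_le (X : Matrix (Fin m) (Fin m) ℂ) : ‖X.trace‖ ≤ m * ‖X‖ := by
  calc ‖X.trace‖ ≤ ∑ i, ‖X i i‖ := norm_sum_le _ _
    _ ≤ ∑ _i : Fin m, ‖X‖ := Finset.sum_le_sum fun i _ => norm_apply_le X i i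
    _ = m * ‖X‖ := by simp

/-- Singular value decomposition in the form used below: with `V` unitary and `D` the diagonal
matrix of singular values, a contraction `U` satisfies `U X = V D V†` and `X = U† V D V†`. -/
lemma exists_polar (X : Matrix (Fin m) (Fin m) ℂ) :
    ∃ (σ : Fin m → ℝ) (V U : Matrix (Fin m) (Fin m) ℂ), (∀ i, 0 ≤ σ i) ∧
      traceNorm X = ∑ i, σ i ∧ ‖V‖ ≤ 1 ∧ ‖U‖ ≤ 1 ∧ Vᴴ * V = 1 ∧
      U * X = V * diagonal (fun i => (σ i : ℂ)) * Vᴴ ∧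
      X = Uᴴ * (V * diagonal (fun i => (σ i : ℂ)) * Vᴴ) := by
  set hX := Matrix.isHermitian_conjTranspose_mul_self X
  set σ : Fin m → ℝ := fun i => Real.sqrt (hX.eigenvalues i) with hσ
  set V : Matrix (Fin m) (Fin m) ℂ := (hX.eigenvectorUnitary : Matrix (Fin m) (Fin m) ℂ) with hV
  have hev : ∀ i, 0 ≤ hX.eigenvalues i :=
    (Matrix.posSemidef_conjTranspose_mul_self X).eigenvalues_nonneg
  have hVV : Vᴴ * V = 1 := Unitary.star_mul_self_of_mem hX.eigenvectorUnitary.2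
  have hVV' : V * Vᴴ = 1 := Unitary.mul_star_self_of_mem hX.eigenvectorUnitary.2
  set D : Matrix (Fin m) (Fin m) ℂ := diagonal (fun i => (σ i : ℂ)) with hD
  -- Since `0⁻¹ = 0`, this is the pseudo-inverse of `D`; `D * D'` is a projection, and the
  -- contraction is `U = V D' V† X†`.
  set D' : Matrix (Fin m) (Fin m) ℂ := diagonal (fun i => ((σ i)⁻¹ : ℂ)) with hD'
  have hsq : ∀ i, σ i * σ i = hX.eigenvalues i := fun i => Real.mul_self_sqrt (hev i)
  have hspec : Xᴴ * X = V * (D * D) * Vᴴ := by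
    have := hX.spectral_theorem
    rw [Unitary.conjStarAlgAut_apply] at this
    rw [this, hD, Matrix.diagonal_mul_diagonal]
    congr 3
    ext i
    simp [← hsq]
  have hstarD : D'ᴴ = D' := by
    rw [hD', Matrix.diagonal_conjTranspose]
    congr 1; ext i; simp
  have hDDD : D' * (D * D) = D := by
    rw [hD, hD', Matrix.diagonal_mul_diagonal, Matrix.diagonal_mul_diagonal]
    congr 1; ext i
    by_cases h : (σ i : ℂ) = 0
    · simp [h]
    · field_simp
  have hP : ‖D * D'‖ ≤ 1 := by
    rw [hD, hD', Matrix.diagonal_mul_diagonal, Matrix.l2_opNorm_diagonal]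
    refine (pi_norm_le_iff_of_nonneg zero_le_one).2 fun i => ?_
    by_cases h : (σ i : ℂ) = 0
    · simp [h]
    · simp [mul_inv_cancel₀ h]
  have hVn : ‖V‖ ≤ 1 := norm_unitary_le _
  have hVn' : ‖Vᴴ‖ ≤ 1 := by rwa [Matrix.l2_opNorm_conjTranspose]
  have hUX : V * D' * Vᴴ * Xᴴ * X = V * D * Vᴴ := by
    calc V * D' * Vᴴ * Xᴴ * X = V * D' * Vᴴ * (Xᴴ * X) := by noncomm_ring
      _ = V * D' * (Vᴴ * V) * (D * D) * Vᴴ := by rw [hspec]; noncomm_ring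
      _ = V * (D' * (D * D)) * Vᴴ := by rw [hVV]; noncomm_ring
      _ = _ := by rw [hDDD]
  refine ⟨σ, V, V * D' * Vᴴ * Xᴴ, fun i => Real.sqrt_nonneg _, rfl, hVn, ?_, hVV, hUX, ?_⟩
  · apply norm_le_one_of_mul_conjTranspose_norm_le
    have : V * D' * Vᴴ * Xᴴ * (V * D' * Vᴴ * Xᴴ)ᴴ = V * (D * D') * Vᴴ := by
      calc V * D' * Vᴴ * Xᴴ * (V * D' * Vᴴ * Xᴴ)ᴴ
          = V * D' * Vᴴ * Xᴴ * X * V * D' * Vᴴ := by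
            simp only [Matrix.conjTranspose_mul, Matrix.conjTranspose_conjTranspose, hstarD]
            noncomm_ring
        _ = V * D * (Vᴴ * V) * D' * Vᴴ := by rw [hUX]; noncomm_ring
        _ = _ := by rw [hVV]; noncomm_ring
    rw [this]
    calc ‖V * (D * D') * Vᴴ‖ ≤ ‖V‖ * ‖D * D'‖ * ‖Vᴴ‖ :=
          (norm_mul_le _ _).trans (by gcongr; exact norm_mul_le _ _)
      _ ≤ 1 * 1 * 1 := by gcongr
      _ = 1 := by norm_num
  -- `X` vanishes on the kernel of `X† X`: the Gram matrix of this product contains the factor `D²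
  -- (1 - D' D) = 0`.
  · have hker : X * (V * (1 - D' * D)) = 0 := by
      rw [← Matrix.conjTranspose_mul_self_eq_zero]
      have hQ : (D * D) * (1 - D' * D) = 0 := by
        have hc : D' * D = D * D' := by
          rw [hD, hD', Matrix.diagonal_mul_diagonal, Matrix.diagonal_mul_diagonal]
          congr 1; ext i; ring
        have : D * D * (D' * D) = D * D := by
          calc D * D * (D' * D) = D * (D * D') * D := by noncomm_ring
            _ = D * (D' * (D * D)) := by rw [← hc]; noncomm_ring
            _ = _ := by rw [hDDD]
        rw [mul_sub, this, mul_one, sub_self]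
      calc (X * (V * (1 - D' * D)))ᴴ * (X * (V * (1 - D' * D)))
          = (V * (1 - D' * D))ᴴ * (Xᴴ * X) * V * (1 - D' * D) := by
            rw [Matrix.conjTranspose_mul X]; noncomm_ring
        _ = (V * (1 - D' * D))ᴴ * V * (D * D) * (Vᴴ * V) * (1 - D' * D) := by
            rw [hspec]; noncomm_ring
        _ = (V * (1 - D' * D))ᴴ * V * ((D * D) * (1 - D' * D)) := by
            rw [hVV]; noncomm_ring
        _ = 0 := by rw [hQ, mul_zero]
    have h2 : X * V * D' * D = X * V := by
      rw [mul_sub, mul_one, mul_sub, sub_eq_zero] at hker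
      simpa only [mul_assoc] using hker.symm
    calc X = X * V * Vᴴ := by rw [mul_assoc, hVV', mul_one]
      _ = X * V * D' * D * Vᴴ := by rw [h2]
      _ = X * V * D' * (Vᴴ * V) * D * Vᴴ := by rw [hVV, mul_one]
      _ = (V * D' * Vᴴ * Xᴴ)ᴴ * (V * D * Vᴴ) := by
        simp only [Matrix.conjTranspose_mul, Matrix.conjTranspose_conjTranspose, hstarD,
          mul_assoc]

lemma traceNorm_nonneg (X : Matrix (Fin m) (Fin m) ℂ) : 0 ≤ traceNorm X :=
  Finset.sum_nonneg fun _ _ => Real.sqrt_nonneg _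

/-- Hölder's inequality between the operator norm and the trace norm. -/
lemma norm_trace_mul_le (B X : Matrix (Fin m) (Fin m) ℂ) :
    ‖(B * X).trace‖ ≤ ‖B‖ * traceNorm X := by
  obtain ⟨σ, V, U, hσ, hX, hV, hU, -, -, h⟩ := exists_polar X
  set D : Matrix (Fin m) (Fin m) ℂ := diagonal (fun i => (σ i : ℂ))
  have hV' : ‖Vᴴ‖ ≤ 1 := by rwa [Matrix.l2_opNorm_conjTranspose]
  have hU' : ‖Uᴴ‖ ≤ 1 := by rwa [Matrix.l2_opNorm_conjTranspose]
  have h1 : (B * X).trace = (Vᴴ * (B * Uᴴ) * V * D).trace := by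
    rw [h, ← mul_assoc, ← mul_assoc, Matrix.trace_mul_comm]
    congr 1; noncomm_ring
  have h2 : ‖Vᴴ * (B * Uᴴ) * V‖ ≤ ‖B‖ := by
    calc ‖Vᴴ * (B * Uᴴ) * V‖ ≤ ‖Vᴴ‖ * (‖B‖ * ‖Uᴴ‖) * ‖V‖ := by
          refine (norm_mul_le _ _).trans ?_
          gcongr
          refine (norm_mul_le _ _).trans ?_
          gcongr
          exact norm_mul_le _ _
      _ ≤ 1 * (‖B‖ * 1) * 1 := by gcongr
      _ = ‖B‖ := by ring
  rw [h1, hX, Finset.mul_sum]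
  refine (norm_sum_le _ _).trans (Finset.sum_le_sum fun i _ => ?_)
  rw [Matrix.diag_apply, Matrix.mul_diagonal, norm_mul, Complex.norm_real, Real.norm_eq_abs,
    abs_of_nonneg (hσ i)]
  exact mul_le_mul_of_nonneg_right ((norm_apply_le _ _ _).trans h2) (hσ i)

/-- The polar factor attains equality in Hölder's inequality. Hence the trace norm is the maximum of
`|Tr (U X)|` over contractions `U`, from which the norm inequalities below follow without any
further use of singular values. -/
lemma exists_traceNorm_eq_trace_mul (X : Matrix (Fin m) (Fin m) ℂ) :
    ∃ U : Matrix (Fin m) (Fin m) ℂ, ‖U‖ ≤ 1 ∧ (traceNorm X : ℂ) = (U * X).trace := by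
  obtain ⟨σ, V, U, hσ, hX, hV, hU, hVV, h, -⟩ := exists_polar X
  refine ⟨U, hU, ?_⟩
  rw [h, Matrix.trace_mul_comm, ← mul_assoc, hVV, one_mul, Matrix.trace_diagonal, hX]
  push_cast; rfl

lemma traceNorm_le_of_forall {X : Matrix (Fin m) (Fin m) ℂ} {c : ℝ}
    (h : ∀ U : Matrix (Fin m) (Fin m) ℂ, ‖U‖ ≤ 1 → ‖(U * X).trace‖ ≤ c) : traceNorm X ≤ c := by
  obtain ⟨U, hU, hX⟩ := exists_traceNorm_eq_trace_mul X
  have := h U hU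
  rwa [← hX, Complex.norm_real, Real.norm_eq_abs, abs_of_nonneg (traceNorm_nonneg X)] at this

lemma traceNorm_add_le (X Y : Matrix (Fin m) (Fin m) ℂ) :
    traceNorm (X + Y) ≤ traceNorm X + traceNorm Y := by
  refine traceNorm_le_of_forall fun U hU => ?_
  rw [mul_add, Matrix.trace_add]
  refine (norm_add_le _ _).trans (add_le_add ?_ ?_)
  · exact (norm_trace_mul_le U X).trans
      (mul_le_of_le_one_left (traceNorm_nonneg X) hU)
  · exact (norm_trace_mul_le U Y).trans
      (mul_le_of_le_one_left (traceNorm_nonneg Y) hU)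

lemma traceNorm_smul_le (c : ℂ) (X : Matrix (Fin m) (Fin m) ℂ) :
    traceNorm (c • X) ≤ ‖c‖ * traceNorm X := by
  refine traceNorm_le_of_forall fun U hU => ?_
  rw [mul_smul_comm, Matrix.trace_smul, norm_smul]
  gcongr
  exact (norm_trace_mul_le U X).trans (mul_le_of_le_one_left (traceNorm_nonneg X) hU)

lemma traceNorm_mul_mul_le (A X B : Matrix (Fin m) (Fin m) ℂ) :
    traceNorm (A * X * B) ≤ ‖A‖ * ‖B‖ * traceNorm X := by
  refine traceNorm_le_of_forall fun U hU => ?_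
  have : (U * (A * X * B)).trace = (B * (U * A) * X).trace := by
    rw [← mul_assoc, Matrix.trace_mul_comm]
    congr 1; noncomm_ring
  rw [this]
  refine (norm_trace_mul_le _ X).trans ?_
  refine mul_le_mul_of_nonneg_right ?_ (traceNorm_nonneg X)
  calc ‖B * (U * A)‖ ≤ ‖B‖ * (‖U‖ * ‖A‖) :=
        (norm_mul_le _ _).trans (by gcongr; exact norm_mul_le _ _)
    _ ≤ ‖B‖ * (1 * ‖A‖) := by gcongr
    _ = ‖A‖ * ‖B‖ := by ring

lemma traceNorm_le_norm (X : Matrix (Fin m) (Fin m) ℂ) : traceNorm X ≤ m * ‖X‖ := by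
  refine traceNorm_le_of_forall fun U hU => (norm_trace_le _).trans ?_
  gcongr
  exact (norm_mul_le _ _).trans (mul_le_of_le_one_left (norm_nonneg X) hU)

lemma norm_le_traceNorm (X : Matrix (Fin m) (Fin m) ℂ) : ‖X‖ ≤ traceNorm X := by
  obtain ⟨σ, V, U, hσ, hX, hV, hU, -, -, h⟩ := exists_polar X
  set D : Matrix (Fin m) (Fin m) ℂ := diagonal (fun i => (σ i : ℂ)) with hDdef
  have hV' : ‖Vᴴ‖ ≤ 1 := by rwa [Matrix.l2_opNorm_conjTranspose]
  have hU' : ‖Uᴴ‖ ≤ 1 := by rwa [Matrix.l2_opNorm_conjTranspose]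
  have hD : ‖D‖ ≤ traceNorm X := by
    rw [hDdef, Matrix.l2_opNorm_diagonal, hX]
    refine (pi_norm_le_iff_of_nonneg (Finset.sum_nonneg fun i _ => hσ i)).2 fun i => ?_
    rw [Complex.norm_real, Real.norm_eq_abs, abs_of_nonneg (hσ i)]
    exact Finset.single_le_sum (fun i _ => hσ i) (Finset.mem_univ i)
  calc ‖X‖ = ‖Uᴴ * (V * D * Vᴴ)‖ := by rw [← h]
    _ ≤ ‖Uᴴ‖ * (‖V‖ * ‖D‖ * ‖Vᴴ‖) := by
        refine (norm_mul_le _ _).trans ?_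
        gcongr
        refine (norm_mul_le _ _).trans ?_
        gcongr
        exact norm_mul_le _ _
    _ ≤ 1 * (1 * traceNorm X * 1) := by
        have := traceNorm_nonneg X
        gcongr
    _ = traceNorm X := by ring

lemma traceNorm_zero : traceNorm (0 : Matrix (Fin m) (Fin m) ℂ) = 0 := by
  refine le_antisymm ?_ (traceNorm_nonneg _)
  simpa using traceNorm_le_norm (0 : Matrix (Fin m) (Fin m) ℂ)

lemma traceNorm_sum_le {ι : Type*} (s : Finset ι) (f : ι → Matrix (Fin m) (Fin m) ℂ) :
    traceNorm (∑ i ∈ s, f i) ≤ ∑ i ∈ s, traceNorm (f i) := by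
  exact Finset.le_sum_of_subadditive _ traceNorm_zero.le traceNorm_add_le s f

end TraceNorm

/-! ### Contractivity of dissipative semigroups. -/

section Contraction

open Matrix
open scoped Matrix.Norms.L2Operator

variable {m : ℕ}

/-- The semigroup generated by a dissipative matrix is contractive. -/
lemma norm_exp_le_one_of_dissipative {A : Matrix (Fin m) (Fin m) ℂ}
    (hA : (-(A + Aᴴ)).PosSemidef) {h : ℝ} (hh : 0 ≤ h) :
    ‖NormedSpace.exp ((h : ℂ) • A)‖ ≤ 1 := by
  have key : ∀ v : EuclideanSpace ℂ (Fin m),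
      ‖Matrix.toEuclideanCLM (𝕜 := ℂ) (NormedSpace.exp ((h : ℂ) • A)) v‖ ≤ ‖v‖ := by
    intro v
    -- Evaluation at `v` is taken as a real-linear map, so that it can be composed with a curve in
    -- real time.
    let ev : Matrix (Fin m) (Fin m) ℂ →ₗ[ℝ] EuclideanSpace ℂ (Fin m) :=
      { toFun := fun X => Matrix.toEuclideanCLM (𝕜 := ℂ) X v
        map_add' := fun X Y => by simp
        map_smul' := fun c X => by
          have : c • X = (c : ℂ) • X := by ext; simp
          rw [this, map_smul]; rfl }
    let evc : Matrix (Fin m) (Fin m) ℂ →L[ℝ] EuclideanSpace ℂ (Fin m) := ev.toContinuousLinearMap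
    set w : ℝ → EuclideanSpace ℂ (Fin m) := fun t => evc (NormedSpace.exp (t • A)) with hw
    have hd : ∀ t, HasDerivAt w (Matrix.toEuclideanCLM (𝕜 := ℂ) A (w t)) t := by
      intro t
      have h1 := hasDerivAt_exp_smul_const' (𝕂 := ℝ) A t
      have h2 := evc.hasFDerivAt.comp_hasDerivAt t h1
      refine h2.congr_deriv ?_
      change Matrix.toEuclideanCLM (𝕜 := ℂ) (A * NormedSpace.exp (t • A)) v = _
      rw [map_mul]; rfl
    have hneg : ∀ u : EuclideanSpace ℂ (Fin m),
        inner ℝ u (Matrix.toEuclideanCLM (𝕜 := ℂ) A u) ≤ 0 := by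
      intro u
      have h1 := hA.re_dotProduct_nonneg u.ofLp
      have h2 : (star u.ofLp ⬝ᵥ (Aᴴ *ᵥ u.ofLp)) = star (star u.ofLp ⬝ᵥ (A *ᵥ u.ofLp)) := by
        rw [Matrix.star_dotProduct, Matrix.star_mulVec, Matrix.conjTranspose_conjTranspose,
          ← Matrix.dotProduct_mulVec]
      rw [Matrix.neg_mulVec, Matrix.add_mulVec, dotProduct_neg, dotProduct_add, h2] at h1
      have h3 : inner ℝ u (Matrix.toEuclideanCLM (𝕜 := ℂ) A u)
          = (star u.ofLp ⬝ᵥ (A *ᵥ u.ofLp)).re := by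
        rw [PiLp.inner_apply]
        simp [Complex.inner, dotProduct, Matrix.ofLp_toEuclideanCLM, mul_comm]
      rw [h3]
      simp at h1
      linarith
    -- Energy estimate: `w' = A w` gives `(‖w‖²)' = 2 Re ⟨w, A w⟩ ≤ 0`.
    have hsq : ∀ t, HasDerivAt (fun t => ‖w t‖ ^ 2)
        (2 * inner ℝ (w t) (Matrix.toEuclideanCLM (𝕜 := ℂ) A (w t))) t := fun t => (hd t).norm_sq
    have hanti : Antitone fun t => ‖w t‖ ^ 2 := by
      refine antitone_of_deriv_nonpos (fun t => (hsq t).differentiableAt) fun t => ?_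
      rw [(hsq t).deriv]
      linarith [hneg (w t)]
    have h0 : w 0 = v := by
      simp only [hw, zero_smul, NormedSpace.exp_zero]
      change Matrix.toEuclideanCLM (𝕜 := ℂ) 1 v = v
      simp
    have hle : ‖w h‖ ^ 2 ≤ ‖w 0‖ ^ 2 := hanti hh
    rw [h0] at hle
    have h1 : w h = Matrix.toEuclideanCLM (𝕜 := ℂ) (NormedSpace.exp ((h : ℂ) • A)) v := by
      have : h • A = (h : ℂ) • A := by ext; simp
      rw [← this]; rfl
    rw [← h1]
    exact (sq_le_sq₀ (norm_nonneg _) (norm_nonneg _)).1 hle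
  rw [Matrix.cstar_norm_def]
  exact ContinuousLinearMap.opNorm_le_bound _ zero_le_one fun v => by simpa using key v

end Contraction

/-! ### Stability of one step of the scheme. -/

namespace LindbladData

open Matrix
open scoped Matrix.Norms.L2Operator

variable {m K : ℕ} {S : LindbladData m K} {T : ℝ}

lemma conjTranspose_A (hS : S.Admissible T) {t : ℝ} (ht : t ∈ Icc 0 T) :
    (S.A t)ᴴ = Complex.I • S.H t - (1 / 2 : ℂ) • ∑ k, (S.γ k t : ℂ) • ((S.L k)ᴴ * S.L k) := by
  simp only [A, Matrix.conjTranspose_sub, Matrix.conjTranspose_smul, Matrix.conjTranspose_sum,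
    Matrix.conjTranspose_mul, Matrix.conjTranspose_conjTranspose, (hS.hermitian t ht).eq]
  simp

/-- The Hamiltonian part of `A` is skew-Hermitian and cancels in `A + A†`; what remains is
dissipative because the `γ k` are nonnegative. -/
lemma posSemidef_neg_A_add (hS : S.Admissible T) {t : ℝ} (ht : t ∈ Icc 0 T) :
    (-(S.A t + (S.A t)ᴴ)).PosSemidef := by
  have h : -(S.A t + (S.A t)ᴴ) = ∑ k, (S.γ k t : ℂ) • ((S.L k)ᴴ * S.L k) := by
    rw [conjTranspose_A hS ht, A]
    module
  rw [h]
  refine Matrix.posSemidef_sum _ fun k _ => ?_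
  refine (Matrix.posSemidef_conjTranspose_mul_self (S.L k)).smul ?_
  exact_mod_cast hS.nonneg k t ht

lemma norm_E_le_one (hS : S.Admissible T) {t : ℝ} (ht : t ∈ Icc 0 T) {h : ℝ} (hh : 0 ≤ h) :
    ‖S.E h t‖ ≤ 1 :=
  norm_exp_le_one_of_dissipative (posSemidef_neg_A_add hS ht) hh

lemma exp_smul_conjTranspose_A (h t : ℝ) :
    NormedSpace.exp ((h : ℂ) • (S.A t)ᴴ) = (S.E h t)ᴴ := by
  rw [E, ← Matrix.exp_conjTranspose, Matrix.conjTranspose_smul]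
  simp

lemma norm_exp_conjTranspose_le_one (hS : S.Admissible T) {t : ℝ} (ht : t ∈ Icc 0 T) {h : ℝ}
    (hh : 0 ≤ h) : ‖NormedSpace.exp ((h : ℂ) • (S.A t)ᴴ)‖ ≤ 1 := by
  rw [exp_smul_conjTranspose_A, Matrix.l2_opNorm_conjTranspose]
  exact norm_E_le_one hS ht hh

/-- The Lindblad equation in terms of the effective Hamiltonian `A`. -/
lemma rhs_eq (hS : S.Admissible T) {t : ℝ} (ht : t ∈ Icc 0 T) (X : Matrix (Fin m) (Fin m) ℂ) :
    S.rhs t X = S.A t * X + X * (S.A t)ᴴ +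
      ∑ k, (S.γ k t : ℂ) • (S.L k * X * (S.L k)ᴴ) := by
  rw [conjTranspose_A hS ht, rhs, A]
  simp only [smul_sub, Finset.sum_sub_distrib, sub_mul, mul_sub, smul_mul_assoc, mul_smul_comm,
    Finset.sum_mul, Finset.mul_sum, smul_add, Finset.sum_add_distrib, Finset.smul_sum]
  simp only [smul_comm (1 / 2 : ℂ)]
  module

lemma le_sSup_γ (hS : S.Admissible T) (k : Fin K) {t : ℝ} (ht : t ∈ Icc 0 T) :
    S.γ k t ≤ sSup (S.γ k '' Icc 0 T) :=
  le_csSup (isCompact_Icc.image_of_continuousOn (hS.contDiffOn_γ k).continuousOn).bddAbove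
    (mem_image_of_mem _ ht)

lemma C₂_nonneg (hS : S.Admissible T) (hT : 0 ≤ T) : 0 ≤ S.C₂ T :=
  Finset.sum_nonneg fun k _ => mul_nonneg
    ((hS.nonneg k 0 ⟨le_rfl, hT⟩).trans (le_sSup_γ hS k ⟨le_rfl, hT⟩)) (sq_nonneg _)

/-- This is where `C₂` arises: each `γ k` is replaced by its maximum and `‖L_k‖` by `‖L_k‖₁`. The
contractions `P`, `Q` stand for the exponentials around the jump, or for `1` in the half step. -/
lemma traceNorm_jump_le (hS : S.Admissible T) {t : ℝ} (ht : t ∈ Icc 0 T)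
    {P Q : Matrix (Fin m) (Fin m) ℂ} (hP : ‖P‖ ≤ 1) (hQ : ‖Q‖ ≤ 1)
    (X : Matrix (Fin m) (Fin m) ℂ) :
    traceNorm (∑ k, (S.γ k t : ℂ) • (P * S.L k * X * (S.L k)ᴴ * Q)) ≤ S.C₂ T * traceNorm X := by
  refine (traceNorm_sum_le _ _).trans ?_
  rw [C₂, Finset.sum_mul]
  refine Finset.sum_le_sum fun k _ => (traceNorm_smul_le _ _).trans ?_
  have hγ := hS.nonneg k t ht
  rw [Complex.norm_real, Real.norm_eq_abs, abs_of_nonneg hγ,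
    mul_assoc (sSup (S.γ k '' Icc 0 T))]
  refine mul_le_mul (le_sSup_γ hS k ht) ?_ (traceNorm_nonneg _) (hγ.trans (le_sSup_γ hS k ht))
  rw [mul_assoc _ _ Q]
  refine (traceNorm_mul_mul_le _ _ _).trans
    (mul_le_mul_of_nonneg_right ?_ (traceNorm_nonneg X))
  rw [sq]
  have hL := norm_le_traceNorm (S.L k)
  have h0 := traceNorm_nonneg (S.L k)
  refine mul_le_mul ?_ ?_ (norm_nonneg _) h0
  · calc ‖P * S.L k‖ ≤ ‖P‖ * ‖S.L k‖ := norm_mul_le _ _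
      _ ≤ 1 * traceNorm (S.L k) := by gcongr
      _ = _ := one_mul _
  · calc ‖(S.L k)ᴴ * Q‖ ≤ ‖(S.L k)ᴴ‖ * ‖Q‖ := norm_mul_le _ _
      _ ≤ traceNorm (S.L k) * 1 := by rw [Matrix.l2_opNorm_conjTranspose]; gcongr
      _ = _ := mul_one _

lemma traceNorm_mul_mul_le_of_norm_le_one {P Q : Matrix (Fin m) (Fin m) ℂ} (hP : ‖P‖ ≤ 1)
    (hQ : ‖Q‖ ≤ 1) (X : Matrix (Fin m) (Fin m) ℂ) : traceNorm (P * X * Q) ≤ traceNorm X :=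
  (traceNorm_mul_mul_le _ _ _).trans <| mul_le_of_le_one_left (traceNorm_nonneg X)
    (mul_le_one₀ hP (norm_nonneg _) hQ)

lemma traceNorm_halfStep_le (hS : S.Admissible T) {τ t : ℝ} (hτ : 0 ≤ τ) (ht : t ∈ Icc 0 T)
    (X : Matrix (Fin m) (Fin m) ℂ) :
    traceNorm (S.halfStep τ t X) ≤ (1 + τ / 2 * S.C₂ T) * traceNorm X := by
  have hτ' : 0 ≤ τ / 2 := by positivity
  refine (traceNorm_mul_mul_le_of_norm_le_one (norm_E_le_one hS ht hτ')
    (norm_exp_conjTranspose_le_one hS ht hτ') _).trans ((traceNorm_add_le _ _).trans ?_)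
  rw [add_mul, one_mul, mul_assoc]
  refine add_le_add le_rfl ((traceNorm_smul_le _ _).trans ?_)
  rw [Complex.norm_real, Real.norm_eq_abs, abs_of_nonneg hτ']
  refine mul_le_mul_of_nonneg_left ?_ hτ'
  simpa using traceNorm_jump_le hS ht norm_one_matrix_le norm_one_matrix_le X

/-- Stability of one step in the trace norm. -/
lemma traceNorm_step_le (hS : S.Admissible T) {τ t : ℝ} (hτ : 0 ≤ τ) (ht : 0 ≤ t)
    (htT : t + τ ≤ T) (X : Matrix (Fin m) (Fin m) ℂ) :
    traceNorm (S.step τ t X) ≤ Real.exp (S.C₂ T * τ) * traceNorm X := by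
  have hτ' : 0 ≤ τ / 2 := by positivity
  have htI : t ∈ Icc 0 T := ⟨ht, by linarith⟩
  have hsI : t + τ / 2 ∈ Icc 0 T := ⟨by linarith, by linarith⟩
  have hC : 0 ≤ S.C₂ T := C₂_nonneg hS (by linarith)
  have h1 : traceNorm (S.step τ t X) ≤
      traceNorm X + τ * (S.C₂ T * ((1 + τ / 2 * S.C₂ T) * traceNorm X)) := by
    refine (traceNorm_add_le _ _).trans (add_le_add
      (traceNorm_mul_mul_le_of_norm_le_one (norm_E_le_one hS hsI hτ)
        (norm_exp_conjTranspose_le_one hS hsI hτ) _) ((traceNorm_smul_le _ _).trans ?_))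
    rw [Complex.norm_real, Real.norm_eq_abs, abs_of_nonneg hτ]
    refine mul_le_mul_of_nonneg_left ?_ hτ
    refine (traceNorm_jump_le hS hsI (norm_E_le_one hS hsI hτ')
        (norm_exp_conjTranspose_le_one hS hsI hτ') _).trans ?_
    exact mul_le_mul_of_nonneg_left (traceNorm_halfStep_le hS hτ htI X) hC
  -- Inserting the half-step factor `1 + x/2`, `x = C₂ τ`, into the jump term gives exactly `1 + x +
  -- x²/2`.
  have h2 := Real.quadratic_le_exp_of_nonneg (mul_nonneg hC hτ)
  calc _ ≤ _ := h1
    _ = (1 + S.C₂ T * τ + (S.C₂ T * τ) ^ 2 / 2) * traceNorm X := by ring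
    _ ≤ _ := mul_le_mul_of_nonneg_right h2 (traceNorm_nonneg X)

lemma step_sub (S : LindbladData m K) (τ t : ℝ) (X Y : Matrix (Fin m) (Fin m) ℂ) :
    S.step τ t (X - Y) = S.step τ t X - S.step τ t Y := by
  simp only [step, halfStep, mul_sub, sub_mul, mul_add, add_mul, smul_sub, smul_add,
    Finset.sum_sub_distrib, Finset.sum_add_distrib]
  abel

end LindbladData

/-! ### Accumulation of local errors. -/

lemma C₃_mono {C₁ C₂ s t : ℝ} (h₁ : 0 ≤ C₁) (h₂ : 0 ≤ C₂) (h : s ≤ t) :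
    C₃ C₁ C₂ s ≤ C₃ C₁ C₂ t := by
  unfold C₃
  split_ifs <;> gcongr

lemma C₃_pos {C₁ C₂ T : ℝ} (h₁ : 0 < C₁) (h₂ : 0 ≤ C₂) (hT : 0 < T) : 0 < C₃ C₁ C₂ T := by
  unfold C₃
  split_ifs with h
  · positivity
  · have h₂' : 0 < C₂ := lt_of_le_of_ne h₂ (Ne.symm h)
    have : 1 < Real.exp (C₂ * T) := Real.one_lt_exp_iff.2 (by positivity)
    exact mul_pos (by positivity) (by linarith)

/-- As a function of time, `C₃` solves `y' = C₂ y + C₁`, `y(0) = 0`. Hence `C₃(s + τ) = e^{C₂ τ}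
C₃(s) + C₃(τ)`, and `C₃(τ) ≥ C₁ τ` by `e^x ≥ 1 + x`. -/
lemma C₃_step_le {C₁ C₂ τ s : ℝ} (h₁ : 0 ≤ C₁) (h₂ : 0 ≤ C₂) :
    C₁ * τ + Real.exp (C₂ * τ) * C₃ C₁ C₂ s ≤ C₃ C₁ C₂ (s + τ) := by
  unfold C₃
  split_ifs with h
  · simp only [h, zero_mul, Real.exp_zero]
    linarith
  · have h₂' : 0 < C₂ := lt_of_le_of_ne h₂ (Ne.symm h)
    have h3 : C₁ * τ = C₁ / C₂ * (C₂ * τ) := by field_simp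
    have h4 : C₂ * τ ≤ Real.exp (C₂ * τ) - 1 := by linarith [Real.add_one_le_exp (C₂ * τ)]
    have h5 : C₁ / C₂ * (C₂ * τ) ≤ C₁ / C₂ * (Real.exp (C₂ * τ) - 1) := by gcongr
    rw [h3, mul_add, Real.exp_add]
    linarith

/-- Local errors of third order accumulate to a global error of second order. -/
lemma traceNorm_sub_numSol_le {m K : ℕ} {S : LindbladData m K} {T : ℝ} (hS : S.Admissible T)
    {ρ : ℝ → Matrix (Fin m) (Fin m) ℂ} {C₁ : ℝ} (hC₁ : 0 ≤ C₁) {N : ℕ} {τ : ℝ} (hτ : 0 ≤ τ)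
    (hNτ : N * τ = T)
    (hloc : ∀ n : ℕ, n < N →
      traceNorm (ρ ((n + 1) * τ) - S.step τ (n * τ) (ρ (n * τ))) ≤ C₁ * τ ^ 3)
    {n : ℕ} (hn : n ≤ N) :
    traceNorm (ρ (n * τ) - S.numSol τ (ρ 0) n) ≤ C₃ C₁ (S.C₂ T) T * τ ^ 2 := by
  have hT : 0 ≤ T := hNτ ▸ by positivity
  have hC₂ := LindbladData.C₂_nonneg hS hT
  have hle : ∀ n : ℕ, n ≤ N → n * τ ≤ T := fun n hn => by
    rw [← hNτ]; gcongr
  -- The induction closes only with the constant for the elapsed time `n τ`; monotonicity of `C₃`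
  -- passes to `T` at the end.
  have key : ∀ n : ℕ, n ≤ N →
      traceNorm (ρ (n * τ) - S.numSol τ (ρ 0) n) ≤ C₃ C₁ (S.C₂ T) (n * τ) * τ ^ 2 := by
    intro n
    induction n with
    | zero =>
      intro _
      simp [LindbladData.numSol, C₃, traceNorm_zero]
    | succ n ih =>
      intro hn
      have hn' : n < N := hn
      -- New error = local error + one step applied to the old error, by linearity of the step.
      have h1 : ρ ((n + 1 : ℕ) * τ) - S.numSol τ (ρ 0) (n + 1) =
          (ρ ((n + 1) * τ) - S.step τ (n * τ) (ρ (n * τ))) +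
            S.step τ (n * τ) (ρ (n * τ) - S.numSol τ (ρ 0) n) := by
        rw [LindbladData.step_sub, LindbladData.numSol]
        push_cast
        abel
      have h2 := LindbladData.traceNorm_step_le hS hτ (t := n * τ) (by positivity)
        (by have := hle (n + 1) hn; push_cast at this; linarith)
        (ρ (n * τ) - S.numSol τ (ρ 0) n)
      rw [h1]
      calc _ ≤ _ := traceNorm_add_le _ _
        _ ≤ C₁ * τ ^ 3 + Real.exp (S.C₂ T * τ) * (C₃ C₁ (S.C₂ T) (n * τ) * τ ^ 2) :=
          add_le_add (hloc n hn') (h2.trans (by gcongr; exact ih hn'.le))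
        _ = (C₁ * τ + Real.exp (S.C₂ T * τ) * C₃ C₁ (S.C₂ T) (n * τ)) * τ ^ 2 := by ring
        _ ≤ C₃ C₁ (S.C₂ T) (n * τ + τ) * τ ^ 2 := by
          gcongr
          exact C₃_step_le hC₁ hC₂
        _ = _ := by push_cast; ring_nf
  refine (key n hn).trans ?_
  gcongr
  exact C₃_mono hC₁ hC₂ (hle n hn)

/-! ### Regularity of the solution and existence of the bound `M`. -/

open Filter

/-- Stating the bound for all large `M` lets finitely many such bounds be met by a single `M`. -/
lemma eventually_norm_iteratedDerivWithin_le {F : Type*} [NormedAddCommGroup F] [NormedSpace ℝ F]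
    {T : ℝ} (hT : 0 < T) {f : ℝ → F} (hf : ContDiffOn ℝ 2 f (Icc 0 T)) :
    ∀ᶠ M : ℝ in atTop, ∀ j ≤ 2, ∀ t ∈ Icc 0 T, ‖iteratedDerivWithin j f (Icc 0 T) t‖ ≤ M := by
  have h : ∀ j : Fin 3, ∀ᶠ M : ℝ in atTop, ∀ t ∈ Icc 0 T,
      ‖iteratedDerivWithin j f (Icc 0 T) t‖ ≤ M := by
    intro j
    have hj : ((j : ℕ) : WithTop ℕ∞) ≤ 2 := by
      exact_mod_cast (show (j : ℕ) ≤ 2 by omega)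
    obtain ⟨C, hC⟩ := isCompact_Icc.exists_bound_of_continuousOn
      (hf.continuousOn_iteratedDerivWithin hj (uniqueDiffOn_Icc hT))
    filter_upwards [eventually_ge_atTop C] with M hM t ht
    exact (hC t ht).trans hM
  filter_upwards [eventually_all.2 h] with M hM j hj
  exact hM ⟨j, by omega⟩

namespace LindbladData

variable {m K : ℕ} {S : LindbladData m K} {T : ℝ}

lemma contDiffOn_γ_coe (hS : S.Admissible T) (k : Fin K) :
    ContDiffOn ℝ 2 (fun t => (S.γ k t : ℂ)) (Icc 0 T) :=
  Complex.ofRealCLM.contDiff.comp_contDiffOn (hS.contDiffOn_γ k)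

lemma contDiffOn_A (hS : S.Admissible T) (a b : Fin m) :
    ContDiffOn ℝ 2 (fun t => S.A t a b) (Icc 0 T) := by
  simp only [A, Matrix.sub_apply, Matrix.smul_apply, Matrix.sum_apply, smul_eq_mul]
  exact (contDiffOn_const.mul (hS.contDiffOn_H a b)).sub
    (contDiffOn_const.mul (ContDiffOn.sum fun k _ =>
      (contDiffOn_γ_coe hS k).mul contDiffOn_const))

lemma contDiffOn_rhs (hS : S.Admissible T) {ρ : ℝ → Matrix (Fin m) (Fin m) ℂ}
    {n : WithTop ℕ∞} (hn : n ≤ 2) (hρ : ∀ a b, ContDiffOn ℝ n (fun t => ρ t a b) (Icc 0 T))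
    (a b : Fin m) : ContDiffOn ℝ n (fun t => S.rhs t (ρ t) a b) (Icc 0 T) := by
  have hmul : ∀ {P Q : ℝ → Matrix (Fin m) (Fin m) ℂ},
      (∀ a b, ContDiffOn ℝ n (fun t => P t a b) (Icc 0 T)) →
      (∀ a b, ContDiffOn ℝ n (fun t => Q t a b) (Icc 0 T)) →
      ∀ a b, ContDiffOn ℝ n (fun t => (P t * Q t) a b) (Icc 0 T) := by
    intro P Q hP hQ a b
    simp only [Matrix.mul_apply]
    exact ContDiffOn.sum fun c _ => (hP a c).mul (hQ c b)
  have hc : ∀ P : Matrix (Fin m) (Fin m) ℂ, ∀ a b,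
      ContDiffOn ℝ n (fun _ : ℝ => P a b) (Icc 0 T) := fun _ _ _ => contDiffOn_const
  have hH := fun a b => (hS.contDiffOn_H a b).of_le hn
  simp only [rhs, Matrix.add_apply, Matrix.sub_apply, Matrix.smul_apply, Matrix.sum_apply,
    smul_eq_mul]
  refine (contDiffOn_const.mul ((hmul hH hρ a b).sub (hmul hρ hH a b))).add
    (ContDiffOn.sum fun k _ => ((contDiffOn_γ_coe hS k).of_le hn).mul ((hmul (hmul (hc _) hρ)
      (hc _) a b).sub (contDiffOn_const.mul ((hmul (hc _) hρ a b).add (hmul hρ (hc _) a b)))))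

lemma IsSolution.contDiffOn (hS : S.Admissible T) (hT : 0 < T)
    {ρ : ℝ → Matrix (Fin m) (Fin m) ℂ} (hρ : S.IsSolution T ρ) (a b : Fin m) :
    ContDiffOn ℝ 2 (fun t => ρ t a b) (Icc 0 T) := by
  have hU := uniqueDiffOn_Icc hT
  have hd : ∀ a b, DifferentiableOn ℝ (fun t => ρ t a b) (Icc 0 T) :=
    fun a b t ht => (hρ t ht a b).differentiableWithinAt
  have hderiv : ∀ a b, ∀ t ∈ Icc 0 T,
      derivWithin (fun t => ρ t a b) (Icc 0 T) t = S.rhs t (ρ t) a b :=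
    fun a b t ht => (hρ t ht a b).derivWithin (hU t ht)
  -- Bootstrapping: the right-hand side is as smooth as `ρ`, up to order two, so each round through
  -- the equation gains a derivative; two rounds lead from continuity to `C²`.
  have step : ∀ n : ℕ, n ≤ 1 → (∀ a b, ContDiffOn ℝ n (fun t => ρ t a b) (Icc 0 T)) →
      ∀ a b, ContDiffOn ℝ (n + 1 : ℕ) (fun t => ρ t a b) (Icc 0 T) := by
    intro n hn h a b
    push_cast
    refine (contDiffOn_succ_iff_derivWithin hU).2 ⟨hd a b, fun h => ?_, ?_⟩
    · exact absurd h (by simp)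
    · refine (contDiffOn_rhs hS ?_ h a b).congr (hderiv a b)
      exact_mod_cast hn.trans one_le_two
  have h0 : ∀ a b, ContDiffOn ℝ (0 : ℕ) (fun t => ρ t a b) (Icc 0 T) := fun a b => by
    simpa using (hd a b).continuousOn
  exact_mod_cast step 1 le_rfl (step 0 zero_le_one h0) a b

lemma exists_boundedBy (hS : S.Admissible T) (hT : 0 < T)
    {ρ : ℝ → Matrix (Fin m) (Fin m) ℂ} (hρ : S.IsSolution T ρ) : ∃ M, S.BoundedBy T M ρ := by
  have h1 := eventually_all.2 fun k => eventually_all.2 fun a => eventually_all.2 fun b =>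
    eventually_ge_atTop ‖S.L k a b‖
  have h2 := eventually_all.2 fun k =>
    eventually_norm_iteratedDerivWithin_le hT (hS.contDiffOn_γ k)
  have h3 := eventually_all.2 fun a => eventually_all.2 fun b =>
    eventually_norm_iteratedDerivWithin_le hT (contDiffOn_A hS a b)
  have h4 := eventually_all.2 fun a => eventually_all.2 fun b =>
    eventually_norm_iteratedDerivWithin_le hT (hρ.contDiffOn hS hT a b)
  obtain ⟨M, h1, h2, h3, h4⟩ := (h1.and (h2.and (h3.and h4))).exists
  exact ⟨M, h1, h2, h3, h4⟩

end LindbladData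

/-! ### Calculus of orders in the step size. -/

open Asymptotics

/-- `f = O(τ ^ n)` along the filter `l`. -/
def IsOrd {ι E : Type*} [Norm E] (l : Filter ι) (τ : ι → ℝ) (n : ℕ) (f : ι → E) : Prop :=
  f =O[l] fun i => τ i ^ n

namespace IsOrd

variable {ι : Type*} {l : Filter ι} {τ : ι → ℝ} {n k : ℕ}

section NormedGroup

variable {E : Type*} [NormedAddCommGroup E]

lemma zero : IsOrd l τ n (fun _ => (0 : E)) := isBigO_zero _ _

lemma const (c : E) : IsOrd l τ 0 (fun _ => c) := by
  simpa [IsOrd] using isBigO_const_const c (one_ne_zero (α := ℝ)) l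

lemma add {f g : ι → E} (hf : IsOrd l τ n f) (hg : IsOrd l τ n g) :
    IsOrd l τ n (fun i => f i + g i) := IsBigO.add hf hg

lemma sub {f g : ι → E} (hf : IsOrd l τ n f) (hg : IsOrd l τ n g) :
    IsOrd l τ n (fun i => f i - g i) := IsBigO.sub hf hg

lemma sum {κ : Type*} {s : Finset κ} {f : κ → ι → E} (hf : ∀ k, IsOrd l τ n (f k)) :
    IsOrd l τ n (fun i => ∑ k ∈ s, f k i) := IsBigO.fun_sum fun k _ => hf k

lemma mono (hτ : τ =O[l] fun _ => (1 : ℝ)) (h : k ≤ n) {f : ι → E} (hf : IsOrd l τ n f) :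
    IsOrd l τ k f := by
  refine hf.trans ?_
  obtain ⟨j, rfl⟩ := Nat.exists_eq_add_of_le h
  have h1 := (isBigO_refl (fun i => τ i ^ k) l).mul (hτ.pow j)
  simpa only [pow_add, one_pow, mul_one] using h1

/-- For steps bounded below, higher powers of `τ` dominate lower ones; this is what makes large
steps easy. -/
lemma mono_of_one_isBigO (hτ : (fun _ => (1 : ℝ)) =O[l] τ) (h : k ≤ n) {f : ι → E}
    (hf : IsOrd l τ k f) : IsOrd l τ n f := by
  refine hf.trans ?_
  obtain ⟨j, rfl⟩ := Nat.exists_eq_add_of_le h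
  have h1 := (isBigO_refl (fun i => τ i ^ k) l).mul (hτ.pow j)
  simpa only [pow_add, one_pow, mul_one] using h1

lemma of_norm_le {f : ι → E} (C : ℝ) (h : ∀ i, ‖f i‖ ≤ C) : IsOrd l τ 0 f :=
  IsBigO.of_bound C (Eventually.of_forall fun i => by simpa using h i)

lemma congr {f g : ι → E} (hf : IsOrd l τ n f) (h : ∀ i, f i = g i) : IsOrd l τ n g := by
  rwa [← funext h]

lemma of_sub {f g : ι → E} (h : IsOrd l τ n (fun i => f i - g i)) (hg : IsOrd l τ n g) :
    IsOrd l τ n f := (h.add hg).congr fun i => by abel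

lemma trans_sub {f g h : ι → E} (h₁ : IsOrd l τ n (fun i => f i - g i))
    (h₂ : IsOrd l τ n (fun i => g i - h i)) : IsOrd l τ n (fun i => f i - h i) :=
  (h₁.add h₂).congr fun i => by abel

end NormedGroup

section NormedSpace

variable {E : Type*} [NormedAddCommGroup E] [NormedSpace ℂ E]

lemma smul {f : ι → ℂ} {g : ι → E} (hf : IsOrd l τ n f) (hg : IsOrd l τ k g) :
    IsOrd l τ (n + k) (fun i => f i • g i) := by
  have := IsBigO.smul hf hg
  simpa only [IsOrd, smul_eq_mul, pow_add] using this

lemma const_smul (c : ℂ) {g : ι → E} (hg : IsOrd l τ n g) : IsOrd l τ n (fun i => c • g i) :=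
  IsBigO.const_smul_left hg c

lemma step_coe : IsOrd l τ 1 (fun i => (τ i : ℂ)) :=
  IsBigO.of_bound 1 (Eventually.of_forall fun i => by simp)

lemma step_smul {f : ι → E} (hf : IsOrd l τ n f) :
    IsOrd l τ (n + 1) (fun i => (τ i : ℂ) • f i) := by
  rw [add_comm]
  exact step_coe.smul hf

end NormedSpace

section NormedRing

variable {R : Type*} [NormedRing R]

lemma mul {f g : ι → R} (hf : IsOrd l τ n f) (hg : IsOrd l τ k g) :
    IsOrd l τ (n + k) (fun i => f i * g i) := by
  have := IsBigO.mul hf hg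
  simpa only [IsOrd, pow_add] using this

lemma bdd_mul {f g : ι → R} (hf : IsOrd l τ 0 f) (hg : IsOrd l τ n g) :
    IsOrd l τ n (fun i => f i * g i) := by
  simpa only [zero_add] using hf.mul hg

lemma mul_bdd {f g : ι → R} (hf : IsOrd l τ n f) (hg : IsOrd l τ 0 g) :
    IsOrd l τ n (fun i => f i * g i) := hf.mul hg

lemma mul_sub_mul {f f' g g' : ι → R} (hf : IsOrd l τ n (fun i => f i - f' i))
    (hg : IsOrd l τ n (fun i => g i - g' i)) (hf' : IsOrd l τ 0 f') (hg₀ : IsOrd l τ 0 g) :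
    IsOrd l τ n (fun i => f i * g i - f' i * g' i) :=
  ((hf.mul_bdd hg₀).add (hf'.bdd_mul hg)).congr fun i => by noncomm_ring

lemma bdd_smul [NormedAlgebra ℂ R] {f : ι → ℂ} {g : ι → R} (hf : IsOrd l τ 0 f)
    (hg : IsOrd l τ n g) : IsOrd l τ n (fun i => f i • g i) := by
  simpa only [zero_add] using hf.smul hg

/-- The exponential agrees with its Taylor polynomials along an infinitesimal bounded family. -/
lemma exp_sub_sum [NormedAlgebra ℂ R] [CompleteSpace R] (hτ : τ =O[l] fun _ => (1 : ℝ)) {z : ι → R}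
    (hz : IsOrd l τ 1 z) (n : ℕ) :
    IsOrd l τ n fun i => NormedSpace.exp (z i) -
      ∑ j ∈ Finset.range n, ((j.factorial : ℂ)⁻¹) • z i ^ j := by
  -- Since `τ` is bounded, `z` stays in a fixed ball, on which the exponential series, of infinite
  -- radius, has a uniform geometric remainder estimate.
  obtain ⟨C, hC⟩ := (hz.mono hτ zero_le_one).bound
  have hC' : ∀ᶠ i in l, ‖z i‖ < |C| + 1 := hC.mono fun i hi => by
    simp only [pow_zero, norm_one, mul_one] at hi
    linarith [le_abs_self C]
  let r : NNReal := ⟨|C| + 1, by positivity⟩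
  obtain ⟨a, -, D, -, h⟩ := (NormedSpace.exp_hasFPowerSeriesOnBall (𝕂 := ℂ)
    (𝔸 := R)).uniform_geometric_approx' (r' := r) ENNReal.coe_lt_top
  have h1 : (fun i => NormedSpace.exp (z i) -
      ∑ j ∈ Finset.range n, ((j.factorial : ℂ)⁻¹) • z i ^ j) =O[l] fun i => ‖z i‖ ^ n := by
    refine IsBigO.of_bound (D * (a / r) ^ n) (hC'.mono fun i hi => ?_)
    have h2 := h (z i) (mem_ball_zero_iff.2 hi) n
    rw [zero_add, FormalMultilinearSeries.partialSum] at h2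
    simp only [NormedSpace.expSeries_apply_eq] at h2
    refine h2.trans (le_of_eq ?_)
    rw [norm_pow, norm_norm, mul_assoc, ← mul_pow]
    ring
  refine h1.trans ?_
  simpa using hz.norm_left.pow n

end NormedRing

end IsOrd

/-! ### The algebraic core: expansion of scheme and solution to third order. -/

section MidpointExpansion

variable {R : Type*} [NormedRing R] [NormedAlgebra ℂ R] {ι : Type*} {l : Filter ι} {τ : ι → ℝ}
  {K : ℕ}

/-- Consistency of the exponential midpoint rule, as an expansion in the step size: `a`, `b` and
`g` are the coefficients at the midpoint, `a'`, `b'` and `g'` those at the left end point, `X`, `Xs`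
and `X₁` the values of the solution at the left end point, the midpoint and the right end point. -/
lemma isOrd_midpoint (hτ : τ =O[l] fun _ => (1 : ℝ)) {a b a' b' X Xs X₁ e f e' f' eh fh : ι → R}
    {g g' : Fin K → ι → ℂ} {L L' : Fin K → ι → R}
    (ha : IsOrd l τ 0 a) (hb : IsOrd l τ 0 b) (hX : IsOrd l τ 0 X) (hg : ∀ k, IsOrd l τ 0 (g k))
    (hL : ∀ k, IsOrd l τ 0 (L k)) (hL' : ∀ k, IsOrd l τ 0 (L' k))
    (ha' : IsOrd l τ 1 fun i => a' i - a i) (hb' : IsOrd l τ 1 fun i => b' i - b i)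
    (hg' : ∀ k, IsOrd l τ 1 fun i => g' k i - g k i)
    (he : IsOrd l τ 3 fun i => e i -
      (1 + (τ i : ℂ) • a i + ((τ i : ℂ) ^ 2 / 2) • (a i * a i)))
    (hf : IsOrd l τ 3 fun i => f i -
      (1 + (τ i : ℂ) • b i + ((τ i : ℂ) ^ 2 / 2) • (b i * b i)))
    (heh : IsOrd l τ 2 fun i => eh i - (1 + ((τ i : ℂ) / 2) • a i))
    (hfh : IsOrd l τ 2 fun i => fh i - (1 + ((τ i : ℂ) / 2) • b i))
    (he' : IsOrd l τ 2 fun i => e' i - (1 + ((τ i : ℂ) / 2) • a' i))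
    (hf' : IsOrd l τ 2 fun i => f' i - (1 + ((τ i : ℂ) / 2) • b' i))
    (hXs : IsOrd l τ 2 fun i => Xs i - X i - ((τ i : ℂ) / 2) •
      (a' i * X i + X i * b' i + ∑ k, g' k i • (L k i * X i * L' k i)))
    (hX₁ : IsOrd l τ 3 fun i => X₁ i - X i - (τ i : ℂ) •
      (a i * Xs i + Xs i * b i + ∑ k, g k i • (L k i * Xs i * L' k i))) :
    IsOrd l τ 3 fun i => X₁ i - (e i * X i * f i + (τ i : ℂ) • ∑ k, g k i •
      (eh i * L k i * (e' i * (X i + ((τ i : ℂ) / 2) • ∑ k, g' k i • (L k i * X i * L' k i)) *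
        f' i) * L' k i * fh i)) := by
  have h01 : IsOrd l τ 0 (fun _ => (1 : R)) := .const 1
  have half : ∀ {n : ℕ} {z : ι → R}, IsOrd l τ n z →
      IsOrd l τ (n + 1) fun i => ((τ i : ℂ) / 2) • z i := fun hz =>
    (hz.step_smul.const_smul (1 / 2)).congr fun i => by module
  have jump : ∀ {n : ℕ} {z : ι → R}, IsOrd l τ n z →
      IsOrd l τ n fun i => ∑ k, g k i • (L k i * z i * L' k i) := fun hz =>
    .sum fun k => (hg k).bdd_smul (((hL k).bdd_mul hz).mul_bdd (hL' k))
  set B : ι → R := fun i => ∑ k, g k i • (L k i * X i * L' k i) with hBdef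
  set D : ι → R := fun i => a i * X i + X i * b i + B i with hDdef
  set B' : ι → R := fun i => ∑ k, g k i • (L k i * D i * L' k i) with hB'def
  set J : ι → R := fun i => ∑ k, g' k i • (L k i * X i * L' k i) with hJdef
  set Z : ι → R := fun i => X i + ((τ i : ℂ) / 2) • D i with hZdef
  -- `Z` is an Euler half step with midpoint coefficients. Both the exact midpoint value `Xs` and
  -- the intermediate value `Y` are compared with it; accuracy `O(τ²)` suffices, as each enters with
  -- a further factor `τ`.
  set Y : ι → R := fun i => e' i * (X i + ((τ i : ℂ) / 2) • J i) * f' i with hYdef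
  have hB : IsOrd l τ 0 B := jump hX
  have hD : IsOrd l τ 0 D := ((ha.mul_bdd hX).add (hX.mul_bdd hb)).add hB
  have hB' : IsOrd l τ 0 B' := jump hD
  have hZ : IsOrd l τ 0 Z := hX.add ((half hD).mono hτ zero_le_one)
  have hJB : IsOrd l τ 1 fun i => J i - B i := by
    refine (IsOrd.sum (s := Finset.univ) fun k =>
      (hg' k).smul (((hL k).bdd_mul hX).mul_bdd (hL' k))).congr fun i => ?_
    simp only [hJdef, hBdef, ← Finset.sum_sub_distrib, sub_smul]
  have hJ : IsOrd l τ 0 J := (hJB.mono hτ zero_le_one).of_sub hB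
  -- Moving coefficients from the left end point to the midpoint costs `O(τ)`, and they carry a
  -- factor `τ / 2`.
  have hXsZ : IsOrd l τ 2 fun i => Xs i - Z i := by
    have h1 : IsOrd l τ 1 fun i => (a' i - a i) * X i + X i * (b' i - b i) + (J i - B i) :=
      ((ha'.mul_bdd hX).add (hX.bdd_mul hb')).add hJB
    refine (hXs.add (half h1)).congr fun i => ?_
    simp only [hZdef, hDdef, sub_mul, mul_sub]
    module
  have hX₁Z : IsOrd l τ 3 fun i => X₁ i - (X i + (τ i : ℂ) •
      (a i * Z i + Z i * b i + (B i + ((τ i : ℂ) / 2) • B' i))) := by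
    have h1 := ((ha.bdd_mul hXsZ).add (hXsZ.mul_bdd hb)).add (jump hXsZ)
    refine (hX₁.add h1.step_smul).congr fun i => ?_
    have h2 : ∑ k, g k i • (L k i * (Xs i - Z i) * L' k i) =
        ∑ k, g k i • (L k i * Xs i * L' k i) - (B i + ((τ i : ℂ) / 2) • B' i) := by
      simp only [hZdef, hBdef, hB'def, Finset.smul_sum, ← Finset.sum_add_distrib,
        ← Finset.sum_sub_distrib]
      refine Finset.sum_congr rfl fun k _ => ?_
      simp only [mul_sub, sub_mul, mul_add, add_mul, mul_smul_comm, smul_mul_assoc]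
      module
    rw [h2, mul_sub, sub_mul]
    module
  have hlin : ∀ {z : ι → R}, IsOrd l τ 0 z → IsOrd l τ 0 fun i => 1 + ((τ i : ℂ) / 2) • z i :=
    fun hz => h01.add ((half hz).mono hτ zero_le_one)
  have hea : IsOrd l τ 2 fun i => e' i - (1 + ((τ i : ℂ) / 2) • a i) :=
    (he'.add (half ha')).congr fun i => by module
  have hfb : IsOrd l τ 2 fun i => f' i - (1 + ((τ i : ℂ) / 2) • b i) :=
    (hf'.add (half hb')).congr fun i => by module
  have hf'0 : IsOrd l τ 0 f' := (hfb.mono hτ (by norm_num)).of_sub (hlin hb)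
  have hfh0 : IsOrd l τ 0 fh := (hfh.mono hτ (by norm_num)).of_sub (hlin hb)
  have hXB : IsOrd l τ 0 fun i => X i + ((τ i : ℂ) / 2) • B i :=
    hX.add ((half hB).mono hτ zero_le_one)
  have hXJ : IsOrd l τ 0 fun i => X i + ((τ i : ℂ) / 2) • J i :=
    hX.add ((half hJ).mono hτ zero_le_one)
  have hXJB : IsOrd l τ 2 fun i => (X i + ((τ i : ℂ) / 2) • J i) -
      (X i + ((τ i : ℂ) / 2) • B i) := (half hJB).congr fun i => by module
  have hYZ : IsOrd l τ 2 fun i => Y i - Z i := by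
    have h1 := (hea.mul_sub_mul hXJB (hlin ha) hXJ).mul_sub_mul hfb
      ((hlin ha).mul_bdd hXB) hf'0
    refine h1.trans_sub ?_
    have h2 : IsOrd l τ 0 fun i => (1 / 4 : ℂ) • (a i * B i + a i * X i * b i + B i * b i) :=
      (((ha.mul_bdd hB).add ((ha.mul_bdd hX).mul_bdd hb)).add (hB.mul_bdd hb)).const_smul _
    have h3 : IsOrd l τ 0 fun i => (1 / 8 : ℂ) • (a i * B i * b i) :=
      ((ha.mul_bdd hB).mul_bdd hb).const_smul _
    refine (h2.step_smul.step_smul.add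
      (h3.step_smul.step_smul.step_smul.mono hτ (by norm_num))).congr fun i => ?_
    simp only [hZdef, hDdef, mul_add, add_mul, mul_smul_comm, smul_mul_assoc, one_mul, mul_one,
      mul_assoc]
    module
  have hY : IsOrd l τ 0 Y := (hYZ.mono hτ (by norm_num)).of_sub hZ
  have hjump : IsOrd l τ 3 fun i => (τ i : ℂ) • ∑ k, g k i • (eh i * L k i * Y i * L' k i * fh i) -
      (τ i : ℂ) • ((1 + ((τ i : ℂ) / 2) • a i) * (B i + ((τ i : ℂ) / 2) • B' i) *
        (1 + ((τ i : ℂ) / 2) • b i)) := by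
    have h1 : ∀ k, IsOrd l τ 2 fun i => eh i * (L k i * Y i * L' k i) * fh i -
        (1 + ((τ i : ℂ) / 2) • a i) * (L k i * Z i * L' k i) * (1 + ((τ i : ℂ) / 2) • b i) := by
      intro k
      have h2 : IsOrd l τ 2 fun i => L k i * Y i * L' k i - L k i * Z i * L' k i :=
        (((hL k).bdd_mul hYZ).mul_bdd (hL' k)).congr fun i => by noncomm_ring
      exact (heh.mul_sub_mul h2 (hlin ha) (((hL k).mul_bdd hY).mul_bdd (hL' k))).mul_sub_mul hfh
        ((hlin ha).mul_bdd (((hL k).mul_bdd hZ).mul_bdd (hL' k))) hfh0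
    refine (IsOrd.sum (s := Finset.univ) fun k =>
      (hg k).bdd_smul (h1 k)).step_smul.congr fun i => ?_
    have h3 : B i + ((τ i : ℂ) / 2) • B' i = ∑ k, g k i • (L k i * Z i * L' k i) := by
      simp only [hZdef, hBdef, hB'def, Finset.smul_sum, ← Finset.sum_add_distrib]
      refine Finset.sum_congr rfl fun k _ => ?_
      simp only [mul_add, add_mul, mul_smul_comm, smul_mul_assoc]
      module
    rw [h3, ← smul_sub]
    simp only [Finset.mul_sum, Finset.sum_mul, ← Finset.sum_sub_distrib]
    refine congrArg _ (Finset.sum_congr rfl fun k _ => ?_)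
    simp only [smul_sub, mul_smul_comm, smul_mul_assoc, mul_assoc]
  have hpoly : IsOrd l τ 0 fun i => 1 + (τ i : ℂ) • a i + ((τ i : ℂ) ^ 2 / 2) • (a i * a i) := by
    have h1 := ((ha.mul_bdd ha).const_smul (1 / 2)).step_smul.step_smul
    refine ((h01.add (ha.step_smul.mono hτ zero_le_one)).add
      (h1.mono hτ (by norm_num))).congr fun i => ?_
    module
  have hpolyb : IsOrd l τ 0 fun i => 1 + (τ i : ℂ) • b i + ((τ i : ℂ) ^ 2 / 2) • (b i * b i) := by
    have h1 := ((hb.mul_bdd hb).const_smul (1 / 2)).step_smul.step_smul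
    refine ((h01.add (hb.step_smul.mono hτ zero_le_one)).add
      (h1.mono hτ (by norm_num))).congr fun i => ?_
    module
  have hf0 : IsOrd l τ 0 f := (hf.mono hτ (by norm_num)).of_sub hpolyb
  have hexp := (he.mul_sub_mul (g := X) (g' := X) (IsOrd.zero.congr fun i => (sub_self _).symm)
    hpoly hX).mul_sub_mul hf (hpoly.mul_bdd hX) hf0
  -- All terms through order `τ²` cancel identically, in noncommuting `a`, `b`, `X`; `h1` and `h2`
  -- list the surviving coefficients of `τ³` and `τ⁴`.
  have hrem : IsOrd l τ 3 fun i => (X i + (τ i : ℂ) •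
      (a i * Z i + Z i * b i + (B i + ((τ i : ℂ) / 2) • B' i))) -
      ((1 + (τ i : ℂ) • a i + ((τ i : ℂ) ^ 2 / 2) • (a i * a i)) * X i *
          (1 + (τ i : ℂ) • b i + ((τ i : ℂ) ^ 2 / 2) • (b i * b i)) +
        (τ i : ℂ) • ((1 + ((τ i : ℂ) / 2) • a i) * (B i + ((τ i : ℂ) / 2) • B' i) *
        (1 + ((τ i : ℂ) / 2) • b i))) := by
    have h1 : IsOrd l τ 0 fun i => (-1 / 2 : ℂ) • (a i * X i * b i * b i + a i * a i * X i * b i) +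
        (-1 / 4 : ℂ) • (a i * B' i + B' i * b i + a i * B i * b i) :=
      (((((ha.mul_bdd hX).mul_bdd hb).mul_bdd hb).add
        (((ha.mul_bdd ha).mul_bdd hX).mul_bdd hb)).const_smul _).add
      ((((ha.mul_bdd hB').add (hB'.mul_bdd hb)).add ((ha.mul_bdd hB).mul_bdd hb)).const_smul _)
    have h2 : IsOrd l τ 0 fun i => (-1 / 4 : ℂ) • (a i * a i * X i * b i * b i) +
        (-1 / 8 : ℂ) • (a i * B' i * b i) :=
      (((((ha.mul_bdd ha).mul_bdd hX).mul_bdd hb).mul_bdd hb).const_smul _).add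
        (((ha.mul_bdd hB').mul_bdd hb).const_smul _)
    refine (h1.step_smul.step_smul.step_smul.add
      (h2.step_smul.step_smul.step_smul.step_smul.mono hτ (by norm_num))).congr fun i => ?_
    simp only [hZdef, hDdef, mul_add, add_mul, mul_smul_comm, smul_mul_assoc, one_mul, mul_one,
      mul_assoc]
    module
  have htotal := (hX₁Z.trans_sub hrem).sub (hexp.add hjump)
  refine htotal.congr fun i => ?_
  abel

end MidpointExpansion

/-! ### Local errors, uniformly over all steps. -/

open scoped Matrix.Norms.L2Operator

/-- The mean value inequality is used twice: for `f'`, then for `f` minus its tangent at `t`. Hence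
the constant `M` instead of the sharp `M / 2`. -/
lemma norm_sub_sub_smul_derivWithin_le {F : Type*} [NormedAddCommGroup F] [NormedSpace ℝ F]
    {f : ℝ → F} {T M : ℝ} (hT : 0 < T) (hf : ContDiffOn ℝ 2 f (Icc 0 T))
    (hM : ∀ t ∈ Icc 0 T, ‖iteratedDerivWithin 2 f (Icc 0 T) t‖ ≤ M) {t u : ℝ} (ht : 0 ≤ t)
    (htu : t ≤ u) (hu : u ≤ T) :
    ‖f u - f t - (u - t) • derivWithin f (Icc 0 T) t‖ ≤ M * (u - t) ^ 2 := by
  have hU := uniqueDiffOn_Icc hT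
  have hf' : ContDiffOn ℝ (1 + 1) f (Icc 0 T) := by rwa [one_add_one_eq_two]
  obtain ⟨hd, -, hd'⟩ := (contDiffOn_succ_iff_derivWithin hU).1 hf'
  have hM' : ∀ t ∈ Icc 0 T, ‖derivWithin (derivWithin f (Icc 0 T)) (Icc 0 T) t‖ ≤ M := by
    intro t ht
    have := hM t ht
    rwa [iteratedDerivWithin_succ, iteratedDerivWithin_one] at this
  have htT : t ∈ Icc 0 T := ⟨ht, htu.trans hu⟩
  have hM0 : 0 ≤ M := (norm_nonneg _).trans (hM t htT)
  have hsub : Icc t u ⊆ Icc 0 T := Icc_subset_Icc ht hu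
  have hlip : ∀ v ∈ Icc t u,
      ‖derivWithin f (Icc 0 T) v - derivWithin f (Icc 0 T) t‖ ≤ M * (u - t) := by
    intro v hv
    refine ((convex_Icc 0 T).norm_image_sub_le_of_norm_derivWithin_le
      (hd'.differentiableOn one_ne_zero) hM' htT (hsub hv)).trans ?_
    rw [Real.norm_eq_abs, abs_of_nonneg (by linarith [hv.1])]
    gcongr
    exact hv.2
  have hg : ∀ v ∈ Icc t u, HasDerivWithinAt
      (fun v => f v - (v - t) • derivWithin f (Icc 0 T) t)
      (derivWithin f (Icc 0 T) v - derivWithin f (Icc 0 T) t) (Icc t u) v := by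
    intro v hv
    have h1 := ((hd v (hsub hv)).hasDerivWithinAt).mono hsub
    have h2 := (((hasDerivAt_id v).sub_const t).smul_const
      (derivWithin f (Icc 0 T) t)).hasDerivWithinAt (s := Icc t u)
    simpa using h1.fun_sub h2
  have h := (convex_Icc t u).norm_image_sub_le_of_norm_hasDerivWithin_le hg hlip
    (left_mem_Icc.2 htu) (right_mem_Icc.2 htu)
  rw [Real.norm_eq_abs, abs_of_nonneg (by linarith)] at h
  calc _ = ‖f u - (u - t) • derivWithin f (Icc 0 T) t -
        (f t - (t - t) • derivWithin f (Icc 0 T) t)‖ := by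
        rw [sub_self, zero_smul, sub_zero, sub_right_comm]
    _ ≤ _ := h
    _ = _ := by ring

lemma isOrd_of_apply {ι : Type*} {m : ℕ} {l : Filter ι} {τ : ι → ℝ} {n : ℕ}
    {f : ι → Matrix (Fin m) (Fin m) ℂ} (h : ∀ a b, IsOrd l τ n fun i => f i a b) :
    IsOrd l τ n f := by
  refine (IsOrd.sum (s := Finset.univ) fun a => IsOrd.sum (s := Finset.univ) fun b =>
    (h a b).smul (IsOrd.const (Matrix.single a b (1 : ℂ)))).congr fun i => ?_
  conv_rhs => rw [Matrix.matrix_eq_sum_single (f i)]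
  simp

lemma IsOrd.conjTranspose {ι : Type*} {m : ℕ} {l : Filter ι} {τ : ι → ℝ} {n : ℕ}
    {f : ι → Matrix (Fin m) (Fin m) ℂ} (h : IsOrd l τ n f) : IsOrd l τ n fun i => (f i)ᴴ :=
  (IsBigO.of_norm_left (by simpa only [Matrix.l2_opNorm_conjTranspose] using h.norm_left))

/-- All situations in which the scheme performs one step, for given bounds on the data: a solution
of a Lindblad equation, a time and a step size. Constants that are uniform over this type depend
on `m`, `K` and `M` only. -/
structure LocalStep (m K : ℕ) (M : ℝ) where
  T : ℝ
  S : LindbladData m K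
  ρ : ℝ → Matrix (Fin m) (Fin m) ℂ
  t : ℝ
  τ : ℝ
  admissible : S.Admissible T
  isSolution : S.IsSolution T ρ
  boundedBy : S.BoundedBy T M ρ
  t_nonneg : 0 ≤ t
  τ_pos : 0 < τ
  t_add_le : t + τ ≤ T

namespace LocalStep

variable {m K : ℕ} {M : ℝ}

lemma T_pos (c : LocalStep m K M) : 0 < c.T := by
  linarith [c.t_nonneg, c.τ_pos, c.t_add_le]

/-- Steps of size at most one. -/
def small (m K : ℕ) (M : ℝ) : Filter (LocalStep m K M) := 𝓟 {c | c.τ ≤ 1}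

/-- Steps of size at least one. -/
def large (m K : ℕ) (M : ℝ) : Filter (LocalStep m K M) := 𝓟 {c | 1 ≤ c.τ}

/-- Steps of size at most one, together with a time inside the step. -/
def points (m K : ℕ) (M : ℝ) : Filter (LocalStep m K M × ℝ) :=
  𝓟 {p | p.1.τ ≤ 1 ∧ p.2 ∈ Icc p.1.t (p.1.t + p.1.τ)}

lemma τ_isBigO_small : (fun c : LocalStep m K M => c.τ) =O[small m K M] fun _ => (1 : ℝ) :=
  IsBigO.of_bound 1 <| eventually_principal.2 fun c hc => by
    simpa [abs_of_pos c.τ_pos] using hc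

lemma τ_isBigO_points :
    (fun p : LocalStep m K M × ℝ => p.1.τ) =O[points m K M] fun _ => (1 : ℝ) :=
  IsBigO.of_bound 1 <| eventually_principal.2 fun p hp => by
    simpa [abs_of_pos p.1.τ_pos] using hp.1

lemma one_isBigO_large : (fun _ => (1 : ℝ)) =O[large m K M] fun c : LocalStep m K M => c.τ :=
  IsBigO.of_bound 1 <| eventually_principal.2 fun c hc => by
    simpa [abs_of_pos c.τ_pos] using hc

lemma tendsto_left : Tendsto (fun c : LocalStep m K M => (c, c.t)) (small m K M)
    (points m K M) :=
  tendsto_principal_principal.2 fun c hc =>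
    ⟨hc, show c.t ≤ c.t from le_rfl, show c.t ≤ c.t + c.τ by linarith [c.τ_pos]⟩

lemma tendsto_mid : Tendsto (fun c : LocalStep m K M => (c, c.t + c.τ / 2)) (small m K M)
    (points m K M) :=
  tendsto_principal_principal.2 fun c hc =>
    ⟨hc, show c.t ≤ c.t + c.τ / 2 by linarith [c.τ_pos],
      show c.t + c.τ / 2 ≤ c.t + c.τ by linarith [c.τ_pos]⟩

lemma isOrd_elapsed : IsOrd (points m K M) (fun p => p.1.τ) 1
    (fun p => ((p.2 - p.1.t : ℝ) : ℂ)) :=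
  IsBigO.of_bound 1 <| eventually_principal.2 fun p hp => by
    obtain ⟨-, h1, h2⟩ := hp
    rw [Complex.norm_real, Real.norm_eq_abs, abs_of_nonneg (by linarith), pow_one,
      Real.norm_eq_abs, abs_of_pos p.1.τ_pos]
    linarith

section Expansion

variable {E : Type*} [NormedAddCommGroup E] [NormedSpace ℂ E]

/-- First order expansion in time at the left end point of a step, uniformly in the step. -/
structure HasExpansion (F : LocalStep m K M → ℝ → E) (F₀ F₁ : LocalStep m K M → E) : Prop where
  zeroth : IsOrd (points m K M) (fun p => p.1.τ) 0 fun p => F₀ p.1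
  first : IsOrd (points m K M) (fun p => p.1.τ) 0 fun p => F₁ p.1
  remainder : IsOrd (points m K M) (fun p => p.1.τ) 2 fun p =>
    F p.1 p.2 - F₀ p.1 - ((p.2 - p.1.t : ℝ) : ℂ) • F₁ p.1

namespace HasExpansion

variable {F G : LocalStep m K M → ℝ → E} {F₀ F₁ G₀ G₁ : LocalStep m K M → E}

lemma bdd (h : HasExpansion F F₀ F₁) :
    IsOrd (points m K M) (fun p => p.1.τ) 0 fun p => F p.1 p.2 :=
  (((h.remainder.mono τ_isBigO_points zero_le_two).add h.zeroth).add
    ((isOrd_elapsed.smul h.first).mono τ_isBigO_points zero_le_one)).congr fun p => by abel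

lemma bdd_left (h : HasExpansion F F₀ F₁) :
    IsOrd (small m K M) (fun c => c.τ) 0 fun c => F c c.t := h.bdd.comp_tendsto tendsto_left

lemma bdd_mid (h : HasExpansion F F₀ F₁) :
    IsOrd (small m K M) (fun c => c.τ) 0 fun c => F c (c.t + c.τ / 2) :=
  h.bdd.comp_tendsto tendsto_mid

lemma remainder_mid (h : HasExpansion F F₀ F₁) :
    IsOrd (small m K M) (fun c => c.τ) 2 fun c =>
      F c (c.t + c.τ / 2) - F₀ c - ((c.τ : ℂ) / 2) • F₁ c :=
  (show IsOrd _ _ _ _ from h.remainder.comp_tendsto tendsto_mid).congr fun c => by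
    simp

lemma left_sub_mid (h : HasExpansion F F₀ F₁) :
    IsOrd (small m K M) (fun c => c.τ) 1 fun c => F c c.t - F c (c.t + c.τ / 2) := by
  have h1 : IsOrd (small m K M) (fun c => c.τ) 2 fun c => F c c.t - F₀ c :=
    (show IsOrd _ _ _ _ from h.remainder.comp_tendsto tendsto_left).congr fun c => by simp
  have h2 : IsOrd (small m K M) (fun c => c.τ) 0 F₁ := h.first.comp_tendsto tendsto_left
  refine (((h1.sub h.remainder_mid).mono τ_isBigO_small one_le_two).sub
    (h2.const_smul (1 / 2)).step_smul).congr fun c => ?_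
  module

lemma add (hF : HasExpansion F F₀ F₁) (hG : HasExpansion G G₀ G₁) :
    HasExpansion (fun c u => F c u + G c u) (fun c => F₀ c + G₀ c) (fun c => F₁ c + G₁ c) :=
  ⟨hF.zeroth.add hG.zeroth, hF.first.add hG.first,
    (hF.remainder.add hG.remainder).congr fun p => by module⟩

lemma sum {κ : Type*} {s : Finset κ} {F : κ → LocalStep m K M → ℝ → E}
    {F₀ F₁ : κ → LocalStep m K M → E} (h : ∀ k, HasExpansion (F k) (F₀ k) (F₁ k)) :
    HasExpansion (fun c u => ∑ k ∈ s, F k c u) (fun c => ∑ k ∈ s, F₀ k c)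
      (fun c => ∑ k ∈ s, F₁ k c) :=
  ⟨.sum fun k => (h k).zeroth, .sum fun k => (h k).first,
    (IsOrd.sum (s := s) fun k => (h k).remainder).congr fun p => by
      simp only [Finset.sum_sub_distrib, Finset.smul_sum]⟩

lemma const {G : LocalStep m K M → E} {C : ℝ} (h : ∀ c, ‖G c‖ ≤ C) :
    HasExpansion (fun c _ => G c) G (fun _ => 0) :=
  ⟨.of_norm_le C fun p => h p.1, .zero, IsOrd.zero.congr fun p => by simp⟩

lemma smul {f : LocalStep m K M → ℝ → ℂ} {f₀ f₁ : LocalStep m K M → ℂ}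
    (hf : HasExpansion f f₀ f₁) (hG : HasExpansion G G₀ G₁) :
    HasExpansion (fun c u => f c u • G c u) (fun c => f₀ c • G₀ c)
      (fun c => f₀ c • G₁ c + f₁ c • G₀ c) := by
  refine ⟨hf.zeroth.smul hG.zeroth, (hf.zeroth.smul hG.first).add (hf.first.smul hG.zeroth), ?_⟩
  -- With `h` the elapsed time and `r` the remainders, the remainder of the product is `r_f G + (f₀
  -- + h f₁) r_G + h² f₁ G₁`.
  have h1 := hf.remainder.smul hG.bdd
  have h2 := (hf.zeroth.add ((isOrd_elapsed.smul hf.first).mono τ_isBigO_points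
    zero_le_one)).smul hG.remainder
  have h3 := isOrd_elapsed.smul (isOrd_elapsed.smul (hf.first.smul hG.first))
  refine ((h1.add h2).add h3).congr fun p => ?_
  simp only [smul_eq_mul]
  module

lemma mul {F G : LocalStep m K M → ℝ → Matrix (Fin m) (Fin m) ℂ}
    {F₀ F₁ G₀ G₁ : LocalStep m K M → Matrix (Fin m) (Fin m) ℂ}
    (hF : HasExpansion F F₀ F₁) (hG : HasExpansion G G₀ G₁) :
    HasExpansion (fun c u => F c u * G c u) (fun c => F₀ c * G₀ c)
      (fun c => F₀ c * G₁ c + F₁ c * G₀ c) := by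
  refine ⟨hF.zeroth.mul hG.zeroth, (hF.zeroth.mul hG.first).add (hF.first.mul hG.zeroth), ?_⟩
  have h1 := hF.remainder.mul hG.bdd
  have h2 := (hF.zeroth.add ((isOrd_elapsed.smul hF.first).mono τ_isBigO_points
    zero_le_one)).mul hG.remainder
  have h3 := isOrd_elapsed.smul (isOrd_elapsed.smul (hF.first.mul hG.first))
  refine ((h1.add h2).add h3).congr fun p => ?_
  simp only [add_mul, mul_sub, sub_mul, mul_smul_comm, smul_mul_assoc]
  module

lemma conjTranspose {F : LocalStep m K M → ℝ → Matrix (Fin m) (Fin m) ℂ}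
    {F₀ F₁ : LocalStep m K M → Matrix (Fin m) (Fin m) ℂ} (h : HasExpansion F F₀ F₁) :
    HasExpansion (fun c u => (F c u)ᴴ) (fun c => (F₀ c)ᴴ) (fun c => (F₁ c)ᴴ) :=
  ⟨h.zeroth.conjTranspose, h.first.conjTranspose, h.remainder.conjTranspose.congr fun p => by
    simp [Matrix.conjTranspose_sub, Matrix.conjTranspose_smul]⟩

lemma of_apply {F : LocalStep m K M → ℝ → Matrix (Fin m) (Fin m) ℂ}
    {F₀ F₁ : LocalStep m K M → Matrix (Fin m) (Fin m) ℂ}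
    (h : ∀ a b, HasExpansion (fun c u => F c u a b) (fun c => F₀ c a b) (fun c => F₁ c a b)) :
    HasExpansion F F₀ F₁ :=
  ⟨isOrd_of_apply fun a b => (h a b).zeroth, isOrd_of_apply fun a b => (h a b).first,
    isOrd_of_apply fun a b => (h a b).remainder⟩

lemma of_norm_le {F₁ : LocalStep m K M → E} {C : ℝ}
    (h₀ : ∀ c, ‖F c c.t‖ ≤ C) (h₁ : ∀ c, ‖F₁ c‖ ≤ C)
    (h₂ : ∀ c, ∀ u, c.t ≤ u → u ≤ c.T →
      ‖F c u - F c c.t - ((u - c.t : ℝ) : ℂ) • F₁ c‖ ≤ C * (u - c.t) ^ 2) :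
    HasExpansion F (fun c => F c c.t) F₁ := by
  refine ⟨.of_norm_le C fun p => h₀ p.1, .of_norm_le C fun p => h₁ p.1,
    IsBigO.of_bound C <| eventually_principal.2 fun p hp => ?_⟩
  obtain ⟨-, h1, h2⟩ := hp
  refine (h₂ p.1 p.2 h1 (h2.trans p.1.t_add_le)).trans ?_
  rw [Real.norm_eq_abs, abs_of_nonneg (by positivity)]
  refine mul_le_mul_of_nonneg_left ?_ ((norm_nonneg _).trans (h₀ p.1))
  have h3 : p.2 - p.1.t ≤ p.1.τ := by linarith
  have h4 : 0 ≤ p.2 - p.1.t := by linarith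
  gcongr

lemma of_contDiffOn {F : LocalStep m K M → ℝ → ℂ}
    (hF : ∀ c, ContDiffOn ℝ 2 (F c) (Icc 0 c.T))
    (hM : ∀ c, ∀ j ≤ 2, ∀ t ∈ Icc 0 c.T, ‖iteratedDerivWithin j (F c) (Icc 0 c.T) t‖ ≤ M) :
    HasExpansion F (fun c => F c c.t) (fun c => derivWithin (F c) (Icc 0 c.T) c.t) := by
  have ht : ∀ c : LocalStep m K M, c.t ∈ Icc 0 c.T := fun c =>
    ⟨c.t_nonneg, by linarith [c.τ_pos, c.t_add_le]⟩
  refine of_norm_le (C := M) (fun c => ?_) (fun c => ?_) fun c u h1 h2 => ?_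
  · simpa using hM c 0 zero_le_two c.t (ht c)
  · simpa [iteratedDerivWithin_one] using hM c 1 one_le_two c.t (ht c)
  · simpa only [Complex.real_smul, smul_eq_mul] using norm_sub_sub_smul_derivWithin_le c.T_pos (hF c)
      (hM c 2 le_rfl) c.t_nonneg h1 h2

end HasExpansion

end Expansion

lemma left_mem (c : LocalStep m K M) : c.t ∈ Icc 0 c.T :=
  ⟨c.t_nonneg, by linarith [c.τ_pos, c.t_add_le]⟩

lemma mid_mem (c : LocalStep m K M) : c.t + c.τ / 2 ∈ Icc 0 c.T :=
  ⟨by linarith [c.t_nonneg, c.τ_pos], by linarith [c.τ_pos, c.t_add_le]⟩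

lemma right_mem (c : LocalStep m K M) : c.t + c.τ ∈ Icc 0 c.T :=
  ⟨by linarith [c.t_nonneg, c.τ_pos], c.t_add_le⟩

lemma exists_norm_le {f : LocalStep m K M → Matrix (Fin m) (Fin m) ℂ}
    (h : ∀ c a b, ‖f c a b‖ ≤ M) : ∃ C, ∀ c, ‖f c‖ ≤ C := by
  have h1 : IsOrd ⊤ (fun c : LocalStep m K M => c.τ) 0 f :=
    isOrd_of_apply fun a b => .of_norm_le M fun c => h c a b
  obtain ⟨C, hC⟩ := isBigO_top.1 h1
  exact ⟨C, fun c => by simpa using hC c⟩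

lemma exists_norm_L_le (k : Fin K) : ∃ C, ∀ c : LocalStep m K M, ‖c.S.L k‖ ≤ C :=
  exists_norm_le fun c => c.boundedBy.bound_L k

lemma norm_ρ_apply_le (c : LocalStep m K M) {u : ℝ} (hu : u ∈ Icc 0 c.T) (a b : Fin m) :
    ‖c.ρ u a b‖ ≤ M := by
  simpa using c.boundedBy.bound_ρ a b 0 zero_le_two u hu

lemma norm_γ_le (c : LocalStep m K M) (k : Fin K) {u : ℝ} (hu : u ∈ Icc 0 c.T) :
    ‖(c.S.γ k u : ℂ)‖ ≤ M := by
  simpa using c.boundedBy.bound_γ k 0 zero_le_two u hu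

lemma hasExpansion_A : ∃ A₀ A₁, HasExpansion (fun (c : LocalStep m K M) u => c.S.A u) A₀ A₁ :=
  ⟨_, fun c => Matrix.of fun a b => derivWithin (fun u => c.S.A u a b) (Icc 0 c.T) c.t,
    .of_apply fun a b => .of_contDiffOn
      (fun c => LindbladData.contDiffOn_A c.admissible a b) fun c => c.boundedBy.bound_A a b⟩

lemma hasExpansion_γ (k : Fin K) :
    ∃ γ₀ γ₁, HasExpansion (fun (c : LocalStep m K M) u => (c.S.γ k u : ℂ)) γ₀ γ₁ := by
  refine ⟨_, fun c => ((derivWithin (c.S.γ k) (Icc 0 c.T) c.t : ℝ) : ℂ), .of_norm_le (C := M)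
    (fun c => norm_γ_le c k c.left_mem) (fun c => ?_) fun c u h1 h2 => ?_⟩
  · simpa [iteratedDerivWithin_one] using c.boundedBy.bound_γ k 1 one_le_two c.t c.left_mem
  · have h := norm_sub_sub_smul_derivWithin_le c.T_pos (c.admissible.contDiffOn_γ k)
      (c.boundedBy.bound_γ k 2 le_rfl) c.t_nonneg h1 h2
    rw [smul_eq_mul] at h ⊢
    rw [← Complex.norm_real] at h
    simpa using h

/-- The first coefficient is given by the equation, which is the form in which `isOrd_midpoint`
needs the half step of the solution. -/
lemma hasExpansion_ρ : HasExpansion (fun (c : LocalStep m K M) u => c.ρ u) (fun c => c.ρ c.t)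
    (fun c => c.S.rhs c.t (c.ρ c.t)) := by
  refine .of_apply fun a b => ?_
  have h : ∀ c : LocalStep m K M, c.S.rhs c.t (c.ρ c.t) a b =
      derivWithin (fun u => c.ρ u a b) (Icc 0 c.T) c.t := fun c =>
    ((c.isSolution c.t c.left_mem a b).derivWithin
      (uniqueDiffOn_Icc c.T_pos c.t c.left_mem)).symm
  simp only [h]
  exact .of_contDiffOn (fun c => c.isSolution.contDiffOn c.admissible c.T_pos a b)
    fun c => c.boundedBy.bound_ρ a b

/-- The derivative of the solution, in terms of the effective Hamiltonian. -/
def velocity (c : LocalStep m K M) (u : ℝ) : Matrix (Fin m) (Fin m) ℂ :=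
  c.S.A u * c.ρ u + c.ρ u * (c.S.A u)ᴴ +
    ∑ k, (c.S.γ k u : ℂ) • (c.S.L k * c.ρ u * (c.S.L k)ᴴ)

lemma hasDerivWithinAt_ρ (c : LocalStep m K M) {u : ℝ} (hu : u ∈ Icc 0 c.T) (a b : Fin m) :
    HasDerivWithinAt (fun s => c.ρ s a b) (c.velocity u a b) (Icc 0 c.T) u := by
  rw [velocity, ← LindbladData.rhs_eq c.admissible hu]
  exact c.isSolution u hu a b

/-- This replaces a bound on the third derivative of `ρ`: expansions are stable under sums and
products, and `velocity` is built from `A`, `ρ`, the `γ k` and bounded constants. -/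
lemma hasExpansion_velocity :
    ∃ R₀ R₁, HasExpansion (fun (c : LocalStep m K M) u => c.velocity u) R₀ R₁ := by
  obtain ⟨A₀, A₁, hA⟩ := hasExpansion_A (m := m) (K := K) (M := M)
  choose γ₀ γ₁ hγ using hasExpansion_γ (m := m) (K := K) (M := M)
  choose C hC using exists_norm_L_le (m := m) (K := K) (M := M)
  exact ⟨_, _, ((hA.mul hasExpansion_ρ).add (hasExpansion_ρ.mul hA.conjTranspose)).add
    (.sum fun k => (hγ k).smul (((HasExpansion.const (hC k)).mul hasExpansion_ρ).mul
      (HasExpansion.const (hC k)).conjTranspose))⟩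

/-- The midpoint rule for the solution. -/
lemma isOrd_solution_midpoint : IsOrd (small m K M) (fun c => c.τ) 3 fun c =>
    c.ρ (c.t + c.τ) - c.ρ c.t - (c.τ : ℂ) • c.velocity (c.t + c.τ / 2) := by
  obtain ⟨R₀, R₁, hR⟩ := hasExpansion_velocity (m := m) (K := K) (M := M)
  have hmid := hR.remainder_mid.step_smul
  obtain ⟨C, hC⟩ := isBigO_principal.1 hR.remainder
  -- Integrating `ρ' = R₀ + (u - t) R₁ + O(τ²)` over the step gives `τ R₀ + (τ²/2) R₁ + O(τ³)`, and
  -- `τ` times the midpoint velocity (`hmid`) has the same expansion.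
  have h : IsOrd (small m K M) (fun c => c.τ) 3 fun c => c.ρ (c.t + c.τ) - c.ρ c.t -
      ((c.τ : ℂ) • R₀ c + ((c.τ : ℂ) ^ 2 / 2) • R₁ c) := by
    refine isOrd_of_apply fun a b => IsBigO.of_bound C <| eventually_principal.2 fun c hc => ?_
    have hτ := c.τ_pos
    have hsub : Icc c.t (c.t + c.τ) ⊆ Icc 0 c.T := Icc_subset_Icc c.t_nonneg c.t_add_le
    have hd : ∀ u ∈ Icc c.t (c.t + c.τ), HasDerivWithinAt
        (fun u => c.ρ u a b - ((u - c.t) • R₀ c a b + ((u - c.t) ^ 2 / 2) • R₁ c a b))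
        (c.velocity u a b - (R₀ c a b + (u - c.t) • R₁ c a b)) (Icc c.t (c.t + c.τ)) u := by
      intro u hu
      have h1 := (hasDerivAt_id u).sub_const c.t
      have h2 := (h1.smul_const (R₀ c a b)).fun_add
        (((h1.fun_pow 2).div_const 2).smul_const (R₁ c a b))
      refine (((hasDerivWithinAt_ρ c (hsub hu) a b).mono hsub).fun_sub
        h2.hasDerivWithinAt).congr_deriv ?_
      simp
    have hb : ∀ u ∈ Icc c.t (c.t + c.τ),
        ‖c.velocity u a b - (R₀ c a b + (u - c.t) • R₁ c a b)‖ ≤ C * c.τ ^ 2 := by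
      intro u hu
      have h1 := (norm_apply_le _ a b).trans (hC (c, u) ⟨hc, hu⟩)
      rw [Real.norm_eq_abs, abs_of_nonneg (by positivity)] at h1
      refine le_trans (le_of_eq ?_) h1
      simp [sub_sub]
    have h1 := (convex_Icc c.t (c.t + c.τ)).norm_image_sub_le_of_norm_hasDerivWithin_le hd hb
      (left_mem_Icc.2 (by linarith)) (right_mem_Icc.2 (by linarith))
    rw [add_sub_cancel_left, Real.norm_eq_abs, abs_of_pos hτ] at h1
    rw [Real.norm_eq_abs, abs_of_nonneg (by positivity)]
    calc _ = _ := by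
          congr 1
          simp
          ring
      _ ≤ _ := h1
      _ = _ := by ring
  refine (h.sub hmid).congr fun c => ?_
  module

lemma isOrd_exp_two {ι : Type*} {l : Filter ι} {τ : ι → ℝ} (hτ : τ =O[l] fun _ => (1 : ℝ))
    {a : ι → Matrix (Fin m) (Fin m) ℂ} (ha : IsOrd l τ 0 a) :
    IsOrd l τ 2 fun i => NormedSpace.exp (((τ i / 2 : ℝ) : ℂ) • a i) -
      (1 + ((τ i : ℂ) / 2) • a i) := by
  have hz : IsOrd l τ 1 fun i => ((τ i / 2 : ℝ) : ℂ) • a i :=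
    (ha.const_smul (1 / 2)).step_smul.congr fun i => by push_cast; module
  refine (IsOrd.exp_sub_sum hτ hz 2).congr fun i => ?_
  simp [Finset.sum_range_succ]

lemma isOrd_exp_three {ι : Type*} {l : Filter ι} {τ : ι → ℝ} (hτ : τ =O[l] fun _ => (1 : ℝ))
    {a : ι → Matrix (Fin m) (Fin m) ℂ} (ha : IsOrd l τ 0 a) :
    IsOrd l τ 3 fun i => NormedSpace.exp ((τ i : ℂ) • a i) -
      (1 + (τ i : ℂ) • a i + ((τ i : ℂ) ^ 2 / 2) • (a i * a i)) := by
  refine (IsOrd.exp_sub_sum hτ ha.step_smul 3).congr fun i => ?_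
  simp only [Finset.sum_range_succ, Finset.sum_range_zero, Nat.factorial, sq, pow_zero, pow_one,
    smul_mul_smul_comm]
  push_cast
  module

/-- Local error of a small step. -/
lemma isOrd_small : IsOrd (small m K M) (fun c => c.τ) 3 fun c =>
    c.ρ (c.t + c.τ) - c.S.step c.τ c.t (c.ρ c.t) := by
  obtain ⟨A₀, A₁, hA⟩ := hasExpansion_A (m := m) (K := K) (M := M)
  choose γ₀ γ₁ hγ using hasExpansion_γ (m := m) (K := K) (M := M)
  choose C hC using exists_norm_L_le (m := m) (K := K) (M := M)
  have hL : ∀ k, IsOrd (small m K M) (fun c => c.τ) 0 fun c => c.S.L k := fun k =>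
    .of_norm_le (C k) (hC k)
  have hτ := τ_isBigO_small (m := m) (K := K) (M := M)
  refine (isOrd_midpoint hτ hA.bdd_mid hA.conjTranspose.bdd_mid hasExpansion_ρ.bdd_left
    (fun k => (hγ k).bdd_mid) hL (fun k => (hL k).conjTranspose) hA.left_sub_mid
    hA.conjTranspose.left_sub_mid (fun k => (hγ k).left_sub_mid)
    (isOrd_exp_three hτ hA.bdd_mid) (isOrd_exp_three hτ hA.conjTranspose.bdd_mid)
    (isOrd_exp_two hτ hA.bdd_mid) (isOrd_exp_two hτ hA.conjTranspose.bdd_mid)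
    (isOrd_exp_two hτ hA.bdd_left) (isOrd_exp_two hτ hA.conjTranspose.bdd_left)
    (hasExpansion_ρ.remainder_mid.congr fun c => by
      rw [LindbladData.rhs_eq c.admissible c.left_mem])
    isOrd_solution_midpoint).congr fun c => ?_
  simp only [LindbladData.step, LindbladData.halfStep, LindbladData.E, Complex.ofReal_div,
    Complex.ofReal_ofNat]

/-- Local error of a large step, from the stability of the scheme. -/
lemma isOrd_large : IsOrd (large m K M) (fun c => c.τ) 3 fun c =>
    c.ρ (c.t + c.τ) - c.S.step c.τ c.t (c.ρ c.t) := by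
  choose C hC using exists_norm_L_le (m := m) (K := K) (M := M)
  have hτ := one_isBigO_large (m := m) (K := K) (M := M)
  have hL : ∀ k, IsOrd (large m K M) (fun c => c.τ) 0 fun c => c.S.L k := fun k =>
    .of_norm_le (C k) (hC k)
  have hρ : ∀ u : LocalStep m K M → ℝ, (∀ c, u c ∈ Icc 0 c.T) →
      IsOrd (large m K M) (fun c => c.τ) 0 fun c => c.ρ (u c) := fun u hu =>
    isOrd_of_apply fun a b => .of_norm_le M fun c => norm_ρ_apply_le c (hu c) a b
  have hγ : ∀ k, ∀ u : LocalStep m K M → ℝ, (∀ c, u c ∈ Icc 0 c.T) →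
      IsOrd (large m K M) (fun c => c.τ) 0 fun c => (c.S.γ k (u c) : ℂ) := fun k u hu =>
    .of_norm_le M fun c => norm_γ_le c k (hu c)
  have hE : ∀ h u : LocalStep m K M → ℝ, (∀ c, 0 ≤ h c) → (∀ c, u c ∈ Icc 0 c.T) →
      IsOrd (large m K M) (fun c => c.τ) 0 fun c => c.S.E (h c) (u c) := fun h u hh hu =>
    .of_norm_le 1 fun c => LindbladData.norm_E_le_one c.admissible (hu c) (hh c)
  have hE' : ∀ h u : LocalStep m K M → ℝ, (∀ c, 0 ≤ h c) → (∀ c, u c ∈ Icc 0 c.T) →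
      IsOrd (large m K M) (fun c => c.τ) 0 fun c =>
        NormedSpace.exp ((h c : ℂ) • (c.S.A (u c))ᴴ) := fun h u hh hu =>
    .of_norm_le 1 fun c =>
      LindbladData.norm_exp_conjTranspose_le_one c.admissible (hu c) (hh c)
  have h0 : ∀ c : LocalStep m K M, 0 ≤ c.τ := fun c => c.τ_pos.le
  have h0' : ∀ c : LocalStep m K M, 0 ≤ c.τ / 2 := fun c => by linarith [c.τ_pos]
  have hX := hρ _ left_mem
  -- The exponentials are contractions however large `τ` is, so `τ` enters only through the explicit
  -- factors: order one here, order two in `hjump`.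
  have hhalf : IsOrd (large m K M) (fun c => c.τ) 1 fun c =>
      c.S.halfStep c.τ c.t (c.ρ c.t) := by
    have h1 : IsOrd (large m K M) (fun c => c.τ) 1 fun c => ((c.τ / 2 : ℝ) : ℂ) •
        ∑ k, (c.S.γ k c.t : ℂ) • (c.S.L k * c.ρ c.t * (c.S.L k)ᴴ) :=
      ((IsOrd.sum (s := Finset.univ) fun k => (hγ k _ left_mem).bdd_smul
        (((hL k).mul_bdd hX).mul_bdd (hL k).conjTranspose)).const_smul (1 / 2)).step_smul.congr
        fun c => by push_cast; module
    exact ((hE _ _ h0' left_mem).bdd_mul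
      ((hX.mono_of_one_isBigO hτ zero_le_one).add h1)).mul_bdd (hE' _ _ h0' left_mem)
  have hjump : IsOrd (large m K M) (fun c => c.τ) 2 fun c => (c.τ : ℂ) •
      ∑ k, (c.S.γ k (c.t + c.τ / 2) : ℂ) • (c.S.E (c.τ / 2) (c.t + c.τ / 2) * c.S.L k *
        c.S.halfStep c.τ c.t (c.ρ c.t) * (c.S.L k)ᴴ *
        NormedSpace.exp (((c.τ / 2 : ℝ) : ℂ) • (c.S.A (c.t + c.τ / 2))ᴴ)) :=
    (IsOrd.sum fun k => (hγ k _ mid_mem).bdd_smul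
      (((((hE _ _ h0' mid_mem).mul_bdd (hL k)).bdd_mul hhalf).mul_bdd
        (hL k).conjTranspose).mul_bdd (hE' _ _ h0' mid_mem))).step_smul
  have hflow := ((hE _ _ h0 mid_mem).mul_bdd hX).mul_bdd (hE' _ _ h0 mid_mem)
  exact ((hρ _ right_mem).mono_of_one_isBigO hτ (Nat.zero_le 3)).sub
    ((hflow.mono_of_one_isBigO hτ (Nat.zero_le 3)).add
      (hjump.mono_of_one_isBigO hτ (by norm_num)))

lemma exists_traceNorm_le (m K : ℕ) (M : ℝ) : ∃ C₁ : ℝ, 0 < C₁ ∧ ∀ c : LocalStep m K M,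
    traceNorm (c.ρ (c.t + c.τ) - c.S.step c.τ c.t (c.ρ c.t)) ≤ C₁ * c.τ ^ 3 := by
  obtain ⟨C, hC⟩ := isBigO_principal.1 (isOrd_small (m := m) (K := K) (M := M))
  obtain ⟨D, hD⟩ := isBigO_principal.1 (isOrd_large (m := m) (K := K) (M := M))
  -- The factor `m` passes from the operator norm to the trace norm; the `+ 1` keeps the constant
  -- positive even if `m = 0`.
  refine ⟨m * (|C| + |D|) + 1, by positivity, fun c => (traceNorm_le_norm _).trans ?_⟩
  have hτ := c.τ_pos
  have h3 : ‖c.τ ^ 3‖ = c.τ ^ 3 := by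
    rw [Real.norm_eq_abs, abs_of_nonneg (by positivity)]
  have h : ‖c.ρ (c.t + c.τ) - c.S.step c.τ c.t (c.ρ c.t)‖ ≤ (|C| + |D|) * c.τ ^ 3 := by
    rcases le_total c.τ 1 with h | h
    · refine (hC c h).trans ?_
      rw [h3]
      gcongr
      linarith [le_abs_self C, abs_nonneg D]
    · refine (hD c h).trans ?_
      rw [h3]
      gcongr
      linarith [le_abs_self D, abs_nonneg C]
  calc _ ≤ m * ((|C| + |D|) * c.τ ^ 3) := by gcongr
    _ ≤ (m * (|C| + |D|) + 1) * c.τ ^ 3 := by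
      rw [← mul_assoc]
      gcongr
      linarith

end LocalStep

end FREM

end

/-! ### The main theorem. -/

theorem theorem3p1 (m K : ℕ) :
    ∃ C₁ : ℝ → ℝ, (∀ M : ℝ, 0 < C₁ M) ∧
      ∀ (T : ℝ), 0 < T →
      ∀ (S : FREM.LindbladData m K), S.Admissible T →
      ∀ (ρ : ℝ → Matrix (Fin m) (Fin m) ℂ), FREM.IsDensityMatrix (ρ 0) → S.IsSolution T ρ →
        (∃ M : ℝ, S.BoundedBy T M ρ) ∧
        ∀ (M : ℝ), S.BoundedBy T M ρ →
          0 < FREM.C₃ (C₁ M) (S.C₂ T) T ∧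
          ∀ (N : ℕ), 0 < N → ∀ (τ : ℝ), τ = T / N →
            (∀ n : ℕ, n < N →
              FREM.traceNorm (ρ ((n + 1) * τ) - S.step τ (n * τ) (ρ (n * τ)))
                ≤ C₁ M * τ ^ 3) ∧
            (∀ n : ℕ, n ≤ N →
              FREM.traceNorm (ρ (n * τ) - S.numSol τ (ρ 0) n)
                ≤ FREM.C₃ (C₁ M) (S.C₂ T) T * τ ^ 2) := by
  -- `C₁` is fixed as a function of `M` before `T`, the data, `ρ` and `N` are introduced.
  choose C₁ hC₁ hloc using FREM.LocalStep.exists_traceNorm_le m K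
  refine ⟨C₁, hC₁, fun T hT S hS ρ _ hρ => ⟨FREM.LindbladData.exists_boundedBy hS hT hρ,
    fun M hM => ⟨FREM.C₃_pos (hC₁ M) (FREM.LindbladData.C₂_nonneg hS hT.le) hT,
      fun N hN τ hτ => ?_⟩⟩⟩
  have hN' : (0 : ℝ) < N := Nat.cast_pos.2 hN
  have hτ0 : 0 < τ := hτ ▸ by positivity
  have hNτ : N * τ = T := by rw [hτ]; field_simp
  have hlocal : ∀ n : ℕ, n < N →
      FREM.traceNorm (ρ ((n + 1) * τ) - S.step τ (n * τ) (ρ (n * τ))) ≤ C₁ M * τ ^ 3 := by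
    intro n hn
    have hn' : ((n : ℝ) + 1) ≤ N := by exact_mod_cast hn
    have hle : n * τ + τ ≤ T := by
      rw [← hNτ, ← add_one_mul]
      gcongr
    have h := hloc M ⟨T, S, ρ, n * τ, τ, hS, hρ, hM, by positivity, hτ0, hle⟩
    rwa [← add_one_mul] at h
  exact ⟨hlocal, fun n hn =>
    FREM.traceNorm_sub_numSol_le hS (hC₁ M).le hτ0.le hNτ hlocal hn⟩
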